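/- Let $\mathbb{K}$ be a field, let $s\ge 1$ and let $t_1,\dots,t_s\ge 1$ be integers. Let $G=G(t_1,\dots,t_s)$ be the finite simple graph consisting of $s$ cycles of lengths $2t_1+1,\dots,2t_s+1$ that all share one common vertex and are otherwise disjoint. Let $I_G$ be its toric ideal, i.e. the kernel of the $\mathbb{K}$-algebra homomorphism $\mathbb{K}[e : e\in E(G)]\to\mathbb{K}[x_v : v\in V(G)]$ with $e\mapsto x_ax_b$ for each edge $e=\{a,b\}$. Then $I_G$ is geometrically vertex decomposable. Here geometric vertex decomposability is defined as follows. For a polynomial ring $R=\mathbb{K}[x_1,\dots,x_n]$, a variable $y$ and $0\neq f\in R$, write $f=\sum_{i=0}^{d}\alpha_iy^i$ with $\alpha_i$ free of $y$ and $\alpha_d\ne 0$, and put $\mathrm{in}_y(f)=\alpha_dy^d$ (and $\mathrm{in}_y(0)=0$); for an ideal $I$ put $\mathrm{in}_y(I)=\langle \mathrm{in}_y(f) : f\in I\rangle$. A monomial order $<$ is $y$-compatible if $\mathrm{in}_<(f)=\mathrm{in}_<(\mathrm{in}_y(f))$ for all $f\in R$. Given a $y$-compatible order and a Gröbner basis $g_1,\dots,g_r$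 of $I$ with respect to it, with $\mathrm{in}_y(g_i)=q_iy^{d_i}$ and $q_i$ free of $y$, put $\mathcal{C}_{y,I}=\langle q_1,\dots,q_r\rangle$ and $\mathcal{N}_{y,I}=\langle q_i : d_i=0\rangle$. An ideal $I\subseteq R$ is geometrically vertex decomposable if it is unmixed (all associated primes of $I$ have the same height) and 1. $I=\langle 1\rangle$, or $I$ is generated by a (possibly empty) subset of the variables, or 2. there are a variable $y$ and a $y$-compatible monomial order such that $\mathrm{in}_y(I)=\mathcal{C}_{y,I}\cap(\mathcal{N}_{y,I}+\langle y\rangle)$ and the contractions of $\mathcal{C}_{y,I}$ and $\mathcal{N}_{y,I}$ to $\mathbb{K}[x_1,\dots,\hat y,\dots,x_n]$ are geometrically vertex decomposable. -/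

import Mathlib

open MvPolynomial

universe u v

/-- The toric ideal `I_G` of a simple graph `G`: the polynomial ring has one variable for each edge
of `G`, and `I_G` is the kernel of the `K`-algebra homomorphism to the polynomial ring on the
vertices that sends an edge `{a, b}` to `x_a * x_b`. -/
noncomputable def toricIdeal (K : Type v) [Field K] {V : Type u} (G : SimpleGraph V) :
    Ideal (MvPolynomial G.edgeSet K) :=
  RingHom.ker (aeval (R := K)
    (fun e : G.edgeSet => (Sym2.map (X : V → MvPolynomial V K) e.1).mul))

/-- The embedding of the vertices `0, 1, …, 2 t_i` of the `i`-th cycle. The vertex `0` goes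
to the common central vertex `none`, the vertex `j + 1` goes to `some ⟨i, j⟩`. -/
def cycleVertex {s : ℕ} (t : Fin s → ℕ) (i : Fin s) (j : Fin (2 * t i + 1)) :
    Option (Σ i : Fin s, Fin (2 * t i)) :=
  (finSuccEquiv (2 * t i) j).map (Sigma.mk i)

/-- The graph `G(t_1, …, t_s)`: cycles of lengths `2 t_i + 1`, all sharing the vertex `none`, and
otherwise disjoint. -/
def oddCyclesGraph {s : ℕ} (t : Fin s → ℕ) :
    SimpleGraph (Option (Σ i : Fin s, Fin (2 * t i))) :=
  ⨆ i : Fin s, (SimpleGraph.cycleGraph (2 * t i + 1)).map (cycleVertex t i)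

section YForms

variable {K : Type v} [Field K] {σ : Type u}

/-- The coefficient `α_d` of the highest power of `y` that occurs in `f`, when `f` is written
as `∑ α_i y ^ i` with `α_i` free of `y`, where `d = f.degreeOf y`. -/
noncomputable def leadCoeffIn (y : σ) (f : MvPolynomial σ K) : MvPolynomial σ K :=
  ∑ a ∈ f.support with a y = f.degreeOf y, monomial (a.erase y) (f.coeff a)

/-- The initial `y`-form `α_d * y ^ d` of `f`. -/
noncomputable def initialForm (y : σ) (f : MvPolynomial σ K) : MvPolynomial σ K :=
  leadCoeffIn y f * X y ^ f.degreeOf y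

/-- The ideal `in_y(I)` generated by the initial `y`-forms of the elements of `I`. -/
noncomputable def initialFormIdeal (y : σ) (I : Ideal (MvPolynomial σ K)) :
    Ideal (MvPolynomial σ K) :=
  Ideal.span (initialForm y '' (I : Set (MvPolynomial σ K)))

variable (K) in
/-- The monomial order `m` is `y`-compatible: `in_m(f) = in_m(in_y(f))` for all `f`. -/
def IsCompatibleOrder (y : σ) (m : MonomialOrder σ) : Prop :=
  ∀ f : MvPolynomial σ K, m.leadingTerm f = m.leadingTerm (initialForm y f)

/-- The finite set `B` is a Gröbner basis of `I` with respect to `m`. -/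
def IsGroebnerBasisOf (m : MonomialOrder σ) (I : Ideal (MvPolynomial σ K))
    (B : Finset (MvPolynomial σ K)) : Prop :=
  (B : Set (MvPolynomial σ K)) ⊆ I ∧
    Ideal.span (m.leadingTerm '' (I : Set (MvPolynomial σ K))) =
      Ideal.span (m.leadingTerm '' (B : Set (MvPolynomial σ K)))

/-- `C_{y,I} = ⟨q_1, …, q_t⟩`, computed from the Gröbner basis `B = {g_1, …, g_t}` of `I`, where
`in_y(g_i) = q_i * y ^ d_i`. -/
noncomputable def idealC (y : σ) (B : Finset (MvPolynomial σ K)) : Ideal (MvPolynomial σ K) :=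
  Ideal.span {q | ∃ g ∈ B, q = leadCoeffIn y g}

/-- `N_{y,I} = ⟨q_i | d_i = 0⟩`, computed from the Gröbner basis `B = {g_1, …, g_t}` of `I`, where
`in_y(g_i) = q_i * y ^ d_i`. -/
noncomputable def idealN (y : σ) (B : Finset (MvPolynomial σ K)) : Ideal (MvPolynomial σ K) :=
  Ideal.span {q | ∃ g ∈ B, g.degreeOf y = 0 ∧ q = leadCoeffIn y g}

/-- The contraction of an ideal to the polynomial ring in the variables other than `y`. -/
noncomputable def contractAway (y : σ) (I : Ideal (MvPolynomial σ K)) :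
    Ideal (MvPolynomial {x : σ // x ≠ y} K) :=
  I.comap (rename (R := K) (Subtype.val : {x : σ // x ≠ y} → σ))

/-- The ideal `I` is unmixed: all associated primes of `I` have the same height. -/
def IsUnmixedIdeal {R : Type*} [CommRing R] (I : Ideal R) : Prop :=
  ∀ p ∈ associatedPrimes R (R ⧸ I), ∀ q ∈ associatedPrimes R (R ⧸ I), p.height = q.height

end YForms

/-- Geometrically vertex decomposable ideals of polynomial rings over `K` (in finitely many
variables, indexed by a type `σ`). -/
inductive IsGVD {K : Type v} [Field K] : {σ : Type u} → Ideal (MvPolynomial σ K) → Prop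
  | top {σ : Type u} (I : Ideal (MvPolynomial σ K)) (hunmixed : IsUnmixedIdeal I)
      (htop : I = ⊤) : IsGVD I
  | variables {σ : Type u} (I : Ideal (MvPolynomial σ K)) (hunmixed : IsUnmixedIdeal I)
      (S : Set σ) (hS : I = Ideal.span (X '' S)) : IsGVD I
  | decompose {σ : Type u} (I : Ideal (MvPolynomial σ K)) (hunmixed : IsUnmixedIdeal I)
      (y : σ) (m : MonomialOrder.{u, u} σ) (hm : IsCompatibleOrder K y m)
      (B : Finset (MvPolynomial σ K)) (hB : IsGroebnerBasisOf m I B)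
      (hin : initialFormIdeal y I = idealC y B ⊓ (idealN y B ⊔ Ideal.span {X y}))
      (hC : IsGVD (contractAway y (idealC y B)))
      (hN : IsGVD (contractAway y (idealN y B))) : IsGVD I

/-! On the `i`-th cycle let `a i` and `b i` be the products of the edges at even and at odd
positions, counted from the common vertex `x₀`. Going once around the odd cycle, the even edges meet
`x₀` twice and every other vertex once, while the odd edges meet every other vertex once. So the
image of `a i` is `x₀ ^ 2` times that of `b i`, and all minors `a i * b j - a j * b i` lie in the
toric ideal. Conversely, if two monomials have the same image, their exponents differ along each
cycle by `±c i` with alternating signs, and the degree of `x₀` forces `∑ c i = 0`. Exchanging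
factors `a i * b j` for `a j * b i` then joins the two monomials. Hence the toric ideal is the ideal
of 2-minors of a two-row matrix of squarefree monomials with disjoint supports.

Such ideals are decomposed by induction on the number of variables (`isGVDOfHeight_minorsIdeal`). If
`y` divides `a i`, the minors involving column `i` are linear in `y`. Here `N` is the minors ideal
of the other columns, and `C` is `N` plus the products `(a i / y) * b j`. The variables of `a i / y`
are then peeled off one at a time. Each step has the form `N + y * C'` with the same kind of `N`,
and the end is an ideal generated by the pairwise coprime monomials `b j`, which is peeled in the
same way.

Two tools make this work. `IsGVD.of_splitOff` replaces Gröbner bases by leading coefficients in `y`: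
it is enough that each element of `C` is the coefficient of `y` in an element of the ideal that is
linear in `y`. Unmixedness is carried along as a presentation as a finite intersection of primes of
one height. In the linear step this needs the minors ideal to be prime (`isPrime_minorsIdeal`),
after which its height is that of its contraction plus one. -/

/-! ### Polynomials viewed as univariate polynomials in one variable -/

section SplitOff

variable {K : Type v} [Field K] {σ : Type u}

open Classical in
/-- A polynomial ring as a univariate polynomial ring in the variable `y` over the polynomial ring
in the other variables. -/
noncomputable def splitOff (y : σ) :
    MvPolynomial σ K ≃ₐ[K] Polynomial (MvPolynomial {x : σ // x ≠ y} K) :=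
  (renameEquiv K (Equiv.optionSubtypeNe y).symm).trans (optionEquivLeft K _)

lemma splitOff_X_self (y : σ) : splitOff y (X y : MvPolynomial σ K) = Polynomial.X := by
  classical simp [splitOff]

lemma splitOff_X_of_ne {y x : σ} (h : x ≠ y) :
    splitOff y (X x : MvPolynomial σ K) = Polynomial.C (X ⟨x, h⟩) := by
  classical simp [splitOff, Equiv.optionSubtypeNe_symm_of_ne h]

lemma splitOff_rename (y : σ) (p : MvPolynomial {x : σ // x ≠ y} K) :
    splitOff y (rename Subtype.val p) = Polynomial.C p := by
  induction p using MvPolynomial.induction_on with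
  | C c =>
    rw [rename_C, ← algebraMap_eq, AlgEquiv.commutes]
    rfl
  | add p q hp hq => rw [map_add, map_add, hp, hq, map_add]
  | mul_X p x hp => rw [map_mul, map_mul, hp, rename_X, splitOff_X_of_ne x.2, map_mul]

lemma natDegree_splitOff (y : σ) (f : MvPolynomial σ K) :
    (splitOff y f).natDegree = f.degreeOf y := by
  classical
  rw [degreeOf_eq_natDegree]
  rfl

lemma monomial_eq_rename_mul_X_pow (y : σ) (a : σ →₀ ℕ) (c : K) :
    monomial a c = rename Subtype.val (monomial (a.subtypeDomain (· ≠ y)) c) * X y ^ a y := by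
  classical
  rw [rename_monomial, X_pow_eq_monomial, monomial_mul, mul_one]
  refine congrArg (fun d => monomial d c) ?_
  ext x
  by_cases hx : x = y
  · subst hx
    rw [Finsupp.add_apply, Finsupp.mapDomain_of_notMem_range _ _ (by simp)]
    simp
  · have := Finsupp.mapDomain_apply (Subtype.val_injective (p := fun x => x ≠ y))
      (a.subtypeDomain (· ≠ y)) ⟨x, hx⟩
    simp only at this
    rw [Finsupp.add_apply, this]
    simp [Ne.symm hx]

lemma rename_monomial_subtypeDomain (y : σ) (a : σ →₀ ℕ) (c : K) :
    rename Subtype.val (monomial (a.subtypeDomain (· ≠ y)) c) = monomial (a.erase y) c := by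
  classical
  have h := monomial_eq_rename_mul_X_pow y (a.erase y) c
  have : (a.erase y).subtypeDomain (· ≠ y) = a.subtypeDomain (· ≠ y) := by
    ext x
    simp [x.2]
  rw [h, this]
  simp

lemma rename_coeff_splitOff (y : σ) (f : MvPolynomial σ K) (d : ℕ) :
    rename Subtype.val ((splitOff y f).coeff d) =
      ∑ a ∈ f.support with a y = d, monomial (a.erase y) (f.coeff a) := by
  classical
  conv_lhs => rw [f.as_sum]
  rw [map_sum, Polynomial.finsetSum_coeff, map_sum, Finset.sum_filter]
  refine Finset.sum_congr rfl fun a _ => ?_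
  rw [monomial_eq_rename_mul_X_pow y, map_mul, map_pow, splitOff_X_self, splitOff_rename,
    Polynomial.coeff_C_mul, Polynomial.coeff_X_pow]
  split_ifs with h1 h2 h2
  · rw [mul_one, rename_monomial_subtypeDomain]
  · exact absurd h1.symm h2
  · exact absurd h2.symm h1
  · simp

lemma leadCoeffIn_eq (y : σ) (f : MvPolynomial σ K) :
    leadCoeffIn y f = rename Subtype.val (splitOff y f).leadingCoeff := by
  classical
  rw [Polynomial.leadingCoeff, rename_coeff_splitOff, natDegree_splitOff, leadCoeffIn]

lemma splitOff_initialForm (y : σ) (f : MvPolynomial σ K) :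
    splitOff y (initialForm y f) =
      Polynomial.C (splitOff y f).leadingCoeff * Polynomial.X ^ (splitOff y f).natDegree := by
  rw [initialForm, leadCoeffIn_eq, map_mul, splitOff_rename, map_pow, splitOff_X_self,
    natDegree_splitOff]

lemma eq_rename_of_degreeOf_eq_zero {y : σ} {f : MvPolynomial σ K} (h : f.degreeOf y = 0) :
    f = rename Subtype.val ((splitOff y f).coeff 0) := by
  rw [← natDegree_splitOff] at h
  apply (splitOff y).injective
  rw [splitOff_rename]
  exact Polynomial.eq_C_of_natDegree_eq_zero h

lemma leadCoeffIn_of_degreeOf_eq_zero {y : σ} {f : MvPolynomial σ K} (h : f.degreeOf y = 0) :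
    leadCoeffIn y f = f := by
  rw [leadCoeffIn_eq, Polynomial.leadingCoeff, natDegree_splitOff, h,
    ← eq_rename_of_degreeOf_eq_zero h]

end SplitOff

/-! ### Elimination orders and their compatibility with initial forms -/

section EliminationOrder

variable {σ : Type u}

/-- The order `m` compares the exponents of `y` first. -/
def MonomialOrder.IsEliminationOrder (m : MonomialOrder σ) (y : σ) : Prop :=
  ∀ a b : σ →₀ ℕ, m.toSyn a ≤ m.toSyn b → a y ≤ b y

lemma exists_isEliminationOrder [Finite σ] (y : σ) :
    ∃ m : MonomialOrder.{u, u} σ, m.IsEliminationOrder y := by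
  classical
  obtain ⟨n, ⟨e⟩⟩ := Finite.exists_equiv_fin σ
  have hn : 0 < n := (e y).pos
  let z : Fin n := ⟨0, hn⟩
  -- In the lexicographic order the smallest index is compared first, so `y` is moved to position
  -- `0`.
  let e' : σ ≃ Fin n := e.trans (Equiv.swap (e y) z)
  have hy : e' y = z := by simp [e']
  let : LinearOrder σ := LinearOrder.lift' e' e'.injective
  refine ⟨MonomialOrder.lex, fun a b h => ?_⟩
  rw [MonomialOrder.lex_le_iff] at h
  rcases h.eq_or_lt with h | h
  · rw [toLex_inj.mp h]
  · obtain ⟨j, hj, hlt⟩ := (Finsupp.Lex.lt_iff).mp h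
    by_cases hjy : j = y
    · subst hjy
      exact hlt.le
    · refine (hj y ?_).le
      change e' y < e' j
      rw [hy]
      refine lt_of_le_of_ne (Nat.zero_le _) fun h' => hjy ?_
      exact e'.injective (h'.symm.trans hy.symm)

variable {K : Type v} [Field K]

namespace MonomialOrder.IsEliminationOrder

variable {m : MonomialOrder σ} {y : σ}

lemma degree_apply (hm : m.IsEliminationOrder y) {f : MvPolynomial σ K} (hf : f ≠ 0) :
    m.degree f y = f.degreeOf y := by
  classical
  refine le_antisymm (monomial_le_degreeOf y (m.degree_mem_support hf)) ?_
  rw [degreeOf_le_iff]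
  exact fun a ha => hm _ _ (m.le_degree ha)

lemma coeff_initialForm (y : σ) (f : MvPolynomial σ K) (a : σ →₀ ℕ) :
    (initialForm y f).coeff a = if a y = f.degreeOf y then f.coeff a else 0 := by
  classical
  have h : initialForm y f = ∑ b ∈ f.support with b y = f.degreeOf y, monomial b (f.coeff b) := by
    rw [initialForm, leadCoeffIn, Finset.sum_mul]
    refine Finset.sum_congr rfl fun b hb => ?_
    rw [← (Finset.mem_filter.mp hb).2, ← rename_monomial_subtypeDomain,
      ← monomial_eq_rename_mul_X_pow]
  rw [h, coeff_sum]
  simp only [coeff_monomial]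
  rw [Finset.sum_ite_eq']
  by_cases h1 : a y = f.degreeOf y
  · simp [h1, eq_comm]
  · simp [h1]

/-- The leading monomial has the maximal exponent of `y`, so it survives in the initial form, whose
support lies in that of `f`. -/
lemma isCompatibleOrder (hm : m.IsEliminationOrder y) : IsCompatibleOrder K y m := by
  classical
  intro f
  by_cases hf : f = 0
  · subst hf
    simp [initialForm, leadCoeffIn]
  have hc : (initialForm y f).coeff (m.degree f) = f.coeff (m.degree f) := by
    rw [coeff_initialForm, if_pos (hm.degree_apply hf)]
  have hdeg : m.degree (initialForm y f) = m.degree f := by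
    apply m.toSyn.injective
    refine le_antisymm ?_ ?_
    · rw [m.degree_le_iff]
      intro b hb
      apply m.le_degree
      rw [mem_support_iff, coeff_initialForm] at hb
      rw [mem_support_iff]
      aesop
    · apply m.le_degree
      rw [mem_support_iff, hc, ← mem_support_iff]
      exact m.degree_mem_support hf
  rw [MonomialOrder.leadingTerm, MonomialOrder.leadingTerm, MonomialOrder.leadingCoeff,
    MonomialOrder.leadingCoeff, hdeg, hc]

end MonomialOrder.IsEliminationOrder

end EliminationOrder

/-! ### Gröbner bases and standard representations -/

section GroebnerBasis

variable {K : Type v} [Field K] {σ : Type u}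

lemma exists_isGroebnerBasisOf [Finite σ] (m : MonomialOrder σ) (I : Ideal (MvPolynomial σ K)) :
    ∃ B, IsGroebnerBasisOf m I B := by
  classical
  have hfg : (Ideal.span (m.leadingTerm '' (I : Set (MvPolynomial σ K)))).FG :=
    IsNoetherian.noetherian _
  obtain ⟨s', hs, hs'⟩ := (Submodule.fg_span_iff_fg_span_finset_subset _).mp hfg
  obtain ⟨B, hB, rfl⟩ := Finset.subset_set_image_iff.mp hs
  refine ⟨B, hB, ?_⟩
  rw [← Finset.coe_image]
  exact hs'

lemma IsGroebnerBasisOf.exists_degree_le {m : MonomialOrder σ} {I : Ideal (MvPolynomial σ K)}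
    {B : Finset (MvPolynomial σ K)} (hB : IsGroebnerBasisOf m I B) {f : MvPolynomial σ K}
    (hf : f ∈ I) (hf0 : f ≠ 0) : ∃ b ∈ B, b ≠ 0 ∧ m.degree b ≤ m.degree f := by
  classical
  have h1 : m.leadingTerm f ∈ Ideal.span ((fun s => monomial s (1 : K)) ''
      {d | ∃ b ∈ B, b ≠ 0 ∧ m.degree b = d}) := by
    have h2 : m.leadingTerm f ∈ Ideal.span (m.leadingTerm '' (B : Set (MvPolynomial σ K))) := by
      rw [← hB.2]
      exact Ideal.subset_span ⟨f, hf, rfl⟩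
    refine Ideal.span_le.mpr ?_ h2
    rintro _ ⟨b, hb, rfl⟩
    by_cases hb0 : b = 0
    · simp [hb0]
    · rw [MonomialOrder.leadingTerm, ← mul_one (m.leadingCoeff b), ← C_mul_monomial]
      exact Ideal.mul_mem_left _ _ (Ideal.subset_span ⟨_, ⟨b, hb, hb0, rfl⟩, rfl⟩)
  rw [mem_ideal_span_monomial_image] at h1
  obtain ⟨_, ⟨b, hb, hb0, rfl⟩, hle⟩ := h1 (m.degree f) (by
    rw [MonomialOrder.leadingTerm, mem_support_iff, coeff_monomial, if_pos rfl]
    exact m.leadingCoeff_ne_zero_iff.mpr hf0)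
  exact ⟨b, hb, hb0, hle⟩

/-- Division by the basis leaves a remainder in `I` none of whose monomials is divisible by a
leading monomial of the basis. By `exists_degree_le` it vanishes. -/
lemma IsGroebnerBasisOf.exists_sum {m : MonomialOrder σ} {I : Ideal (MvPolynomial σ K)}
    {B : Finset (MvPolynomial σ K)} (hB : IsGroebnerBasisOf m I B) {f : MvPolynomial σ K}
    (hf : f ∈ I) : ∃ g : MvPolynomial σ K → MvPolynomial σ K, f = ∑ b ∈ B, b * g b ∧
      ∀ b, m.toSyn (m.degree (b * g b)) ≤ m.toSyn (m.degree f) := by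
  classical
  -- A Gröbner basis may contain `0` here; it is discarded because division needs unit leading
  -- coefficients.
  obtain ⟨g, r, hfg, hdeg, hr⟩ := m.div_set (B := {b | b ∈ B ∧ b ≠ 0})
    (fun b hb => (m.leadingCoeff_ne_zero_iff.mpr hb.2).isUnit) f
  let G : MvPolynomial σ K → MvPolynomial σ K := fun b => if h : b ∈ B ∧ b ≠ 0 then g ⟨b, h⟩ else 0
  have hsum : (Finsupp.linearCombination (MvPolynomial σ K)
      (fun b : {b | b ∈ B ∧ b ≠ 0} => (b : MvPolynomial σ K))) g = ∑ b ∈ B, b * G b := by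
    have hfin : Finite {b | b ∈ B ∧ b ≠ 0} := (B.finite_toSet.subset fun b hb => hb.1).to_subtype
    have := Fintype.ofFinite {b | b ∈ B ∧ b ≠ 0}
    rw [Finsupp.linearCombination_apply, Finsupp.sum_fintype _ _ (by simp)]
    have h0 : ∑ b ∈ B, b * G b = ∑ b ∈ B with b ≠ 0, b * G b := by
      rw [Finset.sum_filter]
      refine Finset.sum_congr rfl fun b _ => ?_
      by_cases hb : b = 0 <;> simp [hb]
    rw [h0]
    refine Finset.sum_bij (fun b _ => b.1) (fun b _ => Finset.mem_filter.mpr b.2)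
      (fun a _ b _ h => Subtype.ext h) (fun b hb => ⟨⟨b, by simpa using hb⟩, by simp⟩) ?_
    intro b _
    have hb : b.1 ∈ B ∧ b.1 ≠ 0 := b.2
    simp only [G, dif_pos hb, smul_eq_mul, mul_comm]
  have hrI : r ∈ I := by
    have : r = f - ∑ b ∈ B, b * G b := by rw [hfg, hsum]; ring
    rw [this]
    exact I.sub_mem hf (I.sum_mem fun b hb => I.mul_mem_right _ (hB.1 hb))
  have hr0 : r = 0 := by
    by_contra h
    obtain ⟨b, hb, hb0, hle⟩ := hB.exists_degree_le hrI h
    exact hr _ (m.degree_mem_support h) b ⟨hb, hb0⟩ hle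
  refine ⟨G, by rw [← hsum]; simpa [hr0] using hfg, fun b => ?_⟩
  by_cases hb : b ∈ B ∧ b ≠ 0
  · simp only [G, dif_pos hb]
    exact hdeg ⟨b, hb⟩
  · simp [G, dif_neg hb]

end GroebnerBasis

/-! ### From leading coefficients to geometric vertex decomposition -/

section Decompose

variable {K : Type v} [Field K] {σ : Type u} {y : σ}

lemma map_splitOff_map_rename (y : σ) (I : Ideal (MvPolynomial {x : σ // x ≠ y} K)) :
    (I.map (rename (R := K) (Subtype.val : {x : σ // x ≠ y} → σ))).map (splitOff y) =
      I.map Polynomial.C := by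
  have h1 : (I.map (rename (R := K) (Subtype.val : {x : σ // x ≠ y} → σ))) =
      I.map ((rename (R := K) (Subtype.val : {x : σ // x ≠ y} → σ)).toRingHom) := rfl
  have h2 : ∀ J : Ideal (MvPolynomial σ K), J.map (splitOff y) =
      J.map (splitOff y : MvPolynomial σ K ≃ₐ[K] _).toRingEquiv.toRingHom := fun J => rfl
  rw [h1, h2, Ideal.map_map]
  congr 1
  exact RingHom.ext (splitOff_rename y)

lemma mem_map_rename_iff {I : Ideal (MvPolynomial {x : σ // x ≠ y} K)} {f : MvPolynomial σ K} :
    f ∈ I.map (rename (R := K) (Subtype.val : {x : σ // x ≠ y} → σ)) ↔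
      ∀ n, (splitOff y f).coeff n ∈ I := by
  rw [← Ideal.mem_map_C_iff, ← map_splitOff_map_rename]
  constructor
  · exact fun h => Ideal.mem_map_of_mem _ h
  · intro h
    obtain ⟨g, hg, hgf⟩ := (Ideal.mem_map_iff_of_surjective _ (splitOff y).surjective).mp h
    rwa [← (splitOff y).injective hgf]

lemma contractAway_map_rename (I : Ideal (MvPolynomial {x : σ // x ≠ y} K)) :
    contractAway y (I.map (rename (R := K) (Subtype.val : {x : σ // x ≠ y} → σ))) = I := by
  ext p
  rw [contractAway, Ideal.mem_comap, mem_map_rename_iff, splitOff_rename]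
  refine ⟨fun h => by simpa using h 0, fun h n => ?_⟩
  rw [Polynomial.coeff_C]
  split_ifs
  · exact h
  · exact I.zero_mem

/-- A criterion for geometric vertex decomposability in terms of univariate polynomials in `y`:
the ideal of leading coefficients consists of leading coefficients of elements that are
linear in `y`. -/
theorem IsGVD.of_splitOff [Finite σ] {I : Ideal (MvPolynomial σ K)} (hI : IsUnmixedIdeal I)
    {C N : Ideal (MvPolynomial {x : σ // x ≠ y} K)}
    (hlc : ∀ f ∈ I, (splitOff y f).leadingCoeff ∈ C)
    (hlin : ∀ c ∈ C, ∃ r : MvPolynomial {x : σ // x ≠ y} K,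
      rename Subtype.val c * X y + rename Subtype.val r ∈ I)
    (hcontr : ∀ p, p ∈ N ↔ rename Subtype.val p ∈ I)
    (hC : IsGVD C) (hN : IsGVD N) : IsGVD I := by
  classical
  obtain ⟨m, hm⟩ := exists_isEliminationOrder y
  obtain ⟨B, hB⟩ := exists_isGroebnerBasisOf m I
  have hCm : idealC y B = C.map (rename (R := K) (Subtype.val : {x : σ // x ≠ y} → σ)) := by
    apply le_antisymm
    · refine Ideal.span_le.mpr ?_
      rintro _ ⟨g, hg, rfl⟩
      rw [leadCoeffIn_eq]
      exact Ideal.mem_map_of_mem _ (hlc g (hB.1 hg))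
    · rw [Ideal.map_le_iff_le_comap]
      intro c hc
      by_cases hc0 : c = 0
      · simp [hc0]
      obtain ⟨r, hr⟩ := hlin c hc
      -- Compare coefficients of `y` in a standard representation of `c * y + r`. Every summand has
      -- `y`-degree at most one, and one of degree exactly one contributes a multiple of
      -- `leadCoeffIn y b`.
      obtain ⟨g, hfg, hdeg⟩ := hB.exists_sum hr
      set f := rename Subtype.val c * X y + rename Subtype.val r with hf
      have hEf : splitOff y f = Polynomial.C c * Polynomial.X + Polynomial.C r := by
        rw [hf, map_add, map_mul, splitOff_rename, splitOff_rename, splitOff_X_self]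
      have hf0 : f ≠ 0 := by
        intro h
        have := congrArg (fun p => Polynomial.coeff p 1) hEf
        simp [h, Polynomial.coeff_C] at this
        exact hc0 this.symm
      have hdf : f.degreeOf y = 1 := by
        rw [← natDegree_splitOff, hEf, Polynomial.natDegree_linear hc0]
      have hc1 : c = ∑ b ∈ B, (splitOff y (b * g b)).coeff 1 := by
        rw [← Polynomial.finsetSum_coeff, ← map_sum, ← hfg, hEf]
        simp [Polynomial.coeff_C]
      rw [Ideal.mem_comap, hc1, map_sum]
      refine Ideal.sum_mem _ fun b hb => ?_
      by_cases h0 : b * g b = 0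
      · simp [h0]
      have hle : (splitOff y (b * g b)).natDegree ≤ 1 := by
        rw [natDegree_splitOff, ← hm.degree_apply h0, ← hdf, ← hm.degree_apply hf0]
        exact hm _ _ (hdeg b)
      rcases hle.eq_or_lt with h1 | h1
      · rw [← h1, ← Polynomial.leadingCoeff, map_mul, Polynomial.leadingCoeff_mul, map_mul,
          ← leadCoeffIn_eq]
        exact Ideal.mul_mem_right _ _ (Ideal.subset_span ⟨b, hb, rfl⟩)
      · rw [Polynomial.coeff_eq_zero_of_natDegree_lt h1]
        simp
  have hNm : idealN y B = N.map (rename (R := K) (Subtype.val : {x : σ // x ≠ y} → σ)) := by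
    apply le_antisymm
    · refine Ideal.span_le.mpr ?_
      rintro _ ⟨g, hg, hg0, rfl⟩
      rw [leadCoeffIn_of_degreeOf_eq_zero hg0, eq_rename_of_degreeOf_eq_zero hg0]
      apply Ideal.mem_map_of_mem
      rw [hcontr, ← eq_rename_of_degreeOf_eq_zero hg0]
      exact hB.1 hg
    · rw [Ideal.map_le_iff_le_comap]
      intro c hc
      by_cases hc0 : c = 0
      · simp [hc0]
      obtain ⟨g, hfg, hdeg⟩ := hB.exists_sum ((hcontr c).mp hc)
      have hf0 : rename (Subtype.val : {x : σ // x ≠ y} → σ) c ≠ 0 := by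
        rw [Ne, map_eq_zero_iff _ (rename_injective _ Subtype.val_injective)]
        exact hc0
      have hdf : (rename (Subtype.val : {x : σ // x ≠ y} → σ) c).degreeOf y = 0 := by
        rw [← natDegree_splitOff, splitOff_rename, Polynomial.natDegree_C]
      rw [Ideal.mem_comap]
      rw [hfg]
      refine Ideal.sum_mem _ fun b hb => ?_
      by_cases h0 : b * g b = 0
      · simp [h0]
      have hle : (splitOff y (b * g b)).natDegree = 0 := by
        rw [natDegree_splitOff, ← hm.degree_apply h0, ← Nat.le_zero, ← hdf, ← hm.degree_apply hf0]
        exact hm _ _ (hdeg b)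
      -- The `y`-degree is additive on products, so a nonzero summand free of `y` comes from a basis
      -- element free of `y`.
      have hb0 : b.degreeOf y = 0 := by
        rw [map_mul, Polynomial.natDegree_mul (by simpa using left_ne_zero_of_mul h0)
          (by simpa using right_ne_zero_of_mul h0)] at hle
        rw [← natDegree_splitOff]
        omega
      exact Ideal.mul_mem_right _ _
        (Ideal.subset_span ⟨b, hb, hb0, (leadCoeffIn_of_degreeOf_eq_zero hb0).symm⟩)
  refine IsGVD.decompose I hI y m hm.isCompatibleOrder B hB ?_ ?_ ?_
  · rw [hCm, hNm]
    apply le_antisymm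
    · refine Ideal.span_le.mpr ?_
      rintro _ ⟨f, hf, rfl⟩
      refine ⟨Ideal.mul_mem_right _ _ ?_, ?_⟩
      · rw [leadCoeffIn_eq]
        exact Ideal.mem_map_of_mem _ (hlc f hf)
      · by_cases h0 : f.degreeOf y = 0
        · apply Ideal.mem_sup_left
          rw [initialForm, h0, leadCoeffIn_of_degreeOf_eq_zero h0, pow_zero, mul_one,
            eq_rename_of_degreeOf_eq_zero h0]
          apply Ideal.mem_map_of_mem
          rwa [hcontr, ← eq_rename_of_degreeOf_eq_zero h0]
        · apply Ideal.mem_sup_right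
          exact Ideal.mul_mem_left _ _
            (Ideal.pow_mem_of_mem _ (Ideal.mem_span_singleton_self _) _ (Nat.pos_of_ne_zero h0))
    -- All `y`-coefficients of `h` lie in `C`, the constant one even in `N`. The constant term is
    -- its own initial form; a higher term `c * y ^ (n + 1)` is a multiple of the initial form `c *
    -- y` of a linear element.
    · rintro h ⟨h1, h2⟩
      rw [SetLike.mem_coe, mem_map_rename_iff] at h1
      have h3 : (splitOff y h).coeff 0 ∈ N := by
        obtain ⟨n, hn, x, hx, rfl⟩ := Submodule.mem_sup.mp h2
        obtain ⟨g, rfl⟩ := Ideal.mem_span_singleton'.mp hx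
        rw [mem_map_rename_iff] at hn
        rw [map_add, map_mul, splitOff_X_self, Polynomial.coeff_add, Polynomial.mul_coeff_zero]
        simpa using hn 0
      have hsum : h = ∑ n ∈ (splitOff y h).support,
          rename Subtype.val ((splitOff y h).coeff n) * X y ^ n := by
        apply (splitOff y).injective
        conv_lhs => rw [(splitOff y h).as_sum_support_C_mul_X_pow]
        rw [map_sum]
        refine Finset.sum_congr rfl fun n _ => ?_
        rw [map_mul, splitOff_rename, map_pow, splitOff_X_self]
      rw [hsum]
      refine Ideal.sum_mem _ fun n _ => ?_
      rcases n with _ | n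
      · have hI0 := (hcontr _).mp h3
        have hd0 : (rename (Subtype.val : {x : σ // x ≠ y} → σ)
            ((splitOff y h).coeff 0)).degreeOf y = 0 := by
          rw [← natDegree_splitOff, splitOff_rename, Polynomial.natDegree_C]
        refine Ideal.subset_span ⟨_, hI0, ?_⟩
        rw [initialForm, hd0, leadCoeffIn_of_degreeOf_eq_zero hd0]
      · set c := (splitOff y h).coeff (n + 1) with hc
        by_cases hc0 : c = 0
        · simp [hc0]
        obtain ⟨r, hr⟩ := hlin c (h1 _)
        rw [pow_succ', ← mul_assoc]
        refine Ideal.mul_mem_right _ _ (Ideal.subset_span ⟨_, hr, ?_⟩)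
        apply (splitOff y).injective
        rw [splitOff_initialForm]
        simp only [map_add, map_mul, splitOff_rename, splitOff_X_self]
        rw [Polynomial.leadingCoeff_linear hc0, Polynomial.natDegree_linear hc0, pow_one]
  · rw [hCm, contractAway_map_rename]
    exact hC
  · rw [hNm, contractAway_map_rename]
    exact hN

end Decompose

/-! ### Heights of primes in a univariate polynomial ring -/

section Height

open Polynomial in
lemma Polynomial.height_map_C_of_isPrime {R : Type*} [CommRing R] [IsNoetherianRing R]
    (p : Ideal R) [p.IsPrime] : (p.map (C : R →+* R[X])).height = p.height := by
  have : (p.map (C : R →+* R[X])).IsPrime := Ideal.isPrime_map_C_of_isPrime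
  have : (p.map (C : R →+* R[X])).LiesOver p := ⟨by
    ext x
    rw [Ideal.under_def, Ideal.mem_comap, Polynomial.algebraMap_eq, Ideal.mem_map_C_iff]
    refine ⟨fun h n => ?_, fun h => by simpa using h 0⟩
    rw [coeff_C]
    split_ifs
    · exact h
    · exact p.zero_mem⟩
  rw [Ideal.height_eq_height_add_of_liesOver_of_hasGoingDown p]
  simp

open Polynomial in
-- Inverting the nonzero constants preserves the height of `Q` and turns it into a nonzero prime of
-- the principal ideal domain `F[X]`.
lemma Polynomial.height_eq_one_of_comap_C_eq_bot {A : Type*} [CommRing A] [IsDomain A]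
    {Q : Ideal A[X]} [hQ : Q.IsPrime] (h0 : Q ≠ ⊥) (hc : Q.comap C = ⊥) : Q.height = 1 := by
  let F := FractionRing A
  let _ := Polynomial.algebra A F
  have : IsLocalization ((nonZeroDivisors A).map (C : A →+* A[X])) F[X] :=
    Polynomial.isLocalization _ _
  have disj : Disjoint ((nonZeroDivisors A).map (C : A →+* A[X]) : Set A[X]) Q := by
    refine Set.disjoint_left.mpr ?_
    rintro _ ⟨b, hb, rfl⟩ hbQ
    have : b ∈ Q.comap C := hbQ
    rw [hc] at this
    exact nonZeroDivisors.ne_zero hb this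
  have hp : (Q.map (algebraMap A[X] F[X])).IsPrime :=
    IsLocalization.isPrime_of_isPrime_disjoint _ _ _ hQ disj
  have hne : Q.map (algebraMap A[X] F[X]) ≠ ⊥ := by
    intro h
    apply h0
    rw [eq_bot_iff]
    intro x hx
    have : algebraMap A[X] F[X] x ∈ Q.map (algebraMap A[X] F[X]) := Ideal.mem_map_of_mem _ hx
    rw [h, Ideal.mem_bot] at this
    have hinj : Function.Injective (algebraMap A[X] F[X]) := by
      rw [Polynomial.algebraMap_def]
      exact Polynomial.map_injective _ (IsFractionRing.injective A F)
    exact (map_eq_zero_iff _ hinj).mp this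
  have := IsPrime.to_maximal_ideal hne
  have h1 := IsPrincipalIdealRing.height_eq_one_of_isMaximal (Q.map (algebraMap A[X] F[X]))
    (Polynomial.not_isField F)
  rwa [IsLocalization.height_map_of_disjoint _ _ disj] at h1

open Polynomial in
-- By going-down, the height of `P` is that of its contraction `p` plus that of its image in `(R ⧸
-- p)[X]`. The image is nonzero and contracts to zero, so it has height one.
lemma Polynomial.height_eq_height_comap_add_one {R : Type*} [CommRing R] [IsNoetherianRing R]
    (P : Ideal R[X]) [P.IsPrime] (hne : P ≠ (P.comap C).map C) :
    P.height = (P.comap C).height + 1 := by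
  set p := P.comap (C : R →+* R[X]) with hp
  have : P.LiesOver p := ⟨rfl⟩
  suffices h : (P.map (Ideal.Quotient.mk (p.map (algebraMap R R[X])))).height = 1 by
    rw [Ideal.height_eq_height_add_of_liesOver_of_hasGoingDown p, h]
  let e : (R[X] ⧸ (p.map (algebraMap R R[X]))) ≃+* (R ⧸ p)[X] :=
    (Ideal.polynomialQuotientEquivQuotientPolynomial p).symm
  have hle : p.map (algebraMap R R[X]) ≤ P := Ideal.map_comap_le
  have hP1 : (P.map (Ideal.Quotient.mk (p.map (algebraMap R R[X])))).IsPrime :=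
    Ideal.map_isPrime_of_surjective Ideal.Quotient.mk_surjective (by rwa [Ideal.mk_ker])
  have hmem : ∀ x, Ideal.Quotient.mk (p.map (algebraMap R R[X])) x ∈
      P.map (Ideal.Quotient.mk (p.map (algebraMap R R[X]))) ↔ x ∈ P := by
    intro x
    rw [← Ideal.mem_comap, Ideal.comap_map_of_surjective _ Ideal.Quotient.mk_surjective]
    have : Ideal.comap (Ideal.Quotient.mk (p.map (algebraMap R R[X]))) ⊥ ≤ P := by
      rw [← RingHom.ker_eq_comap_bot, Ideal.mk_ker]
      exact hle
    rw [sup_eq_left.mpr this]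
  rw [← e.symm.height_comap]
  apply Polynomial.height_eq_one_of_comap_C_eq_bot
  · intro h
    apply hne
    refine le_antisymm (fun x hx => ?_) hle
    have h1 : e (Ideal.Quotient.mk _ x) ∈ Ideal.comap e.symm
        (P.map (Ideal.Quotient.mk (p.map (algebraMap R R[X])))) := by
      rw [Ideal.mem_comap, e.symm_apply_apply, hmem]
      exact hx
    rw [h, Ideal.mem_bot, map_eq_zero_iff _ e.injective, Ideal.Quotient.eq_zero_iff_mem] at h1
    exact h1
  · rw [eq_bot_iff]
    intro x hx
    obtain ⟨r, rfl⟩ := Ideal.Quotient.mk_surjective x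
    have h1 : e.symm (C (Ideal.Quotient.mk p r)) = Ideal.Quotient.mk _ (C r) := by
      have := Ideal.polynomialQuotientEquivQuotientPolynomial_map_mk p (C r)
      rw [Polynomial.map_C] at this
      exact this
    rw [Ideal.mem_comap, Ideal.mem_comap, h1, hmem] at hx
    exact Ideal.Quotient.eq_zero_iff_mem.mpr hx

end Height

/-! ### Unmixedness from intersections of primes of equal height -/

section PrimeDecomposition

/-- `I` is a finite intersection of prime ideals of height `h`. -/
def IsInfOfPrimesOfHeight {R : Type*} [CommRing R] (h : ℕ) (I : Ideal R) : Prop :=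
  ∃ S : Finset (Ideal R), (∀ P ∈ S, P.IsPrime ∧ P.height = h) ∧ I = S.inf id

namespace IsInfOfPrimesOfHeight

variable {R : Type*} [CommRing R] {h : ℕ} {I J : Ideal R}

/-- The empty intersection: the unit ideal counts for every `h`, so inductions may end in it. -/
lemma top : IsInfOfPrimesOfHeight h (⊤ : Ideal R) := ⟨∅, by simp, by simp⟩

lemma of_isPrime (hI : I.IsPrime) (hh : I.height = h) : IsInfOfPrimesOfHeight h I :=
  ⟨{I}, by simp [hI, hh], by simp⟩

lemma inf (hI : IsInfOfPrimesOfHeight h I) (hJ : IsInfOfPrimesOfHeight h J) :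
    IsInfOfPrimesOfHeight h (I ⊓ J) := by
  classical
  obtain ⟨S, hS, rfl⟩ := hI
  obtain ⟨T, hT, rfl⟩ := hJ
  refine ⟨S ∪ T, fun P hP => ?_, by rw [Finset.inf_union]⟩
  rcases Finset.mem_union.mp hP with hP | hP
  · exact hS P hP
  · exact hT P hP

/-- The class is stable under operations on ideals that preserve finite intersections and send
primes of height `h` to primes of height `h'`. -/
lemma of_map_inf {R' : Type*} [CommRing R'] {h' : ℕ} (hI : IsInfOfPrimesOfHeight h I)
    (F : InfTopHom (Ideal R) (Ideal R'))
    (hF : ∀ P : Ideal R, P.IsPrime → P.height = h → (F P).IsPrime ∧ (F P).height = h') :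
    IsInfOfPrimesOfHeight h' (F I) := by
  classical
  obtain ⟨S, hS, rfl⟩ := hI
  refine ⟨S.image F, fun P hP => ?_, ?_⟩
  · obtain ⟨Q, hQ, rfl⟩ := Finset.mem_image.mp hP
    exact hF Q (hS Q hQ).1 (hS Q hQ).2
  · rw [map_finset_inf, Finset.inf_image]
    rfl

/-- An associated prime is the annihilator of the class of some `x`, that is, the intersection of
those `P ∈ S` that omit `x`. Being prime, it equals one of them; `S` need not be irredundant. -/
lemma isUnmixedIdeal [IsNoetherianRing R] (hI : IsInfOfPrimesOfHeight h I) :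
    IsUnmixedIdeal I := by
  classical
  obtain ⟨S, hS, rfl⟩ := hI
  suffices H : ∀ p ∈ associatedPrimes R (R ⧸ S.inf id), p.height = h from
    fun p hp q hq => (H p hp).trans (H q hq).symm
  intro p hp
  obtain ⟨hprime, x, hx⟩ := (isAssociatedPrime_iff).mp (AssociatedPrimes.mem_iff.mp hp)
  obtain ⟨x, rfl⟩ := Ideal.Quotient.mk_surjective x
  have hmem : ∀ r, r ∈ p ↔ ∀ P ∈ S, r * x ∈ P := by
    intro r
    have h1 : r ∈ p ↔ Ideal.Quotient.mk (S.inf id) (r * x) = 0 := by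
      rw [hx, Submodule.mem_colon_singleton, Submodule.mem_bot]
      rfl
    rw [h1, Ideal.Quotient.eq_zero_iff_mem, Submodule.mem_finsetInf]
    rfl
  have hle : (S.filter (x ∉ ·)).inf id ≤ p := by
    intro r hr
    rw [hmem]
    intro P hP
    by_cases hxP : x ∈ P
    · exact P.mul_mem_left _ hxP
    · rw [Submodule.mem_finsetInf] at hr
      exact P.mul_mem_right _ (hr P (Finset.mem_filter.mpr ⟨hP, hxP⟩))
  obtain ⟨P, hP, hPp⟩ := (hprime.inf_le').mp hle
  obtain ⟨hPS, hxP⟩ := Finset.mem_filter.mp hP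
  have : p = P := by
    refine le_antisymm (fun r hr => ?_) hPp
    exact ((hS P hPS).1.mem_or_mem ((hmem r).mp hr P hPS)).resolve_right hxP
  rw [this]
  exact (hS P hPS).2

lemma comap_ringEquiv {R' : Type*} [CommRing R'] (e : R' ≃+* R)
    (hI : IsInfOfPrimesOfHeight h I) : IsInfOfPrimesOfHeight h (I.comap e) := by
  refine hI.of_map_inf ⟨⟨Ideal.comap e, fun _ _ => rfl⟩, rfl⟩ fun P hP hh => ⟨?_, ?_⟩
  · exact Ideal.IsPrime.comap (e : R' →+* R)
  · exact (e.height_comap P).trans hh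

open Polynomial in
lemma map_C [IsNoetherianRing R] (hI : IsInfOfPrimesOfHeight h I) :
    IsInfOfPrimesOfHeight h (I.map (Polynomial.C : R →+* R[X])) := by
  refine hI.of_map_inf ⟨⟨Ideal.map Polynomial.C, fun I J => ?_⟩, Ideal.map_top _⟩
    fun P hP hh => ⟨?_, ?_⟩
  · ext f
    simp only [Ideal.mem_inf, Ideal.mem_map_C_iff, forall_and]
  · exact Ideal.isPrime_map_C_of_isPrime
  · exact (Polynomial.height_map_C_of_isPrime P).trans hh

open Polynomial in
-- This is the passage from `P` to `P + (X)`: it contracts to `P` and contains `X`, so it is not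
-- extended from `P` and the height rises by one.
lemma comap_constantCoeff [IsNoetherianRing R] (hI : IsInfOfPrimesOfHeight h I) :
    IsInfOfPrimesOfHeight (h + 1) (I.comap (Polynomial.constantCoeff : R[X] →+* R)) := by
  refine hI.of_map_inf ⟨⟨Ideal.comap Polynomial.constantCoeff, fun _ _ => rfl⟩, rfl⟩
    fun P hP hh => ⟨?_, ?_⟩
  · exact Ideal.IsPrime.comap _
  · have hprime : (P.comap (Polynomial.constantCoeff : R[X] →+* R)).IsPrime := Ideal.IsPrime.comap _
    have hc : (P.comap (Polynomial.constantCoeff : R[X] →+* R)).comap Polynomial.C = P := by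
      ext r
      simp
    have := Polynomial.height_eq_height_comap_add_one
      (P.comap (Polynomial.constantCoeff : R[X] →+* R)) (by
      rw [hc]
      intro heq
      have hX : (Polynomial.X : R[X]) ∈ P.comap (Polynomial.constantCoeff : R[X] →+* R) := by simp
      rw [heq, Ideal.mem_map_C_iff] at hX
      exact hP.ne_top ((Ideal.eq_top_iff_one _).mpr (by simpa using hX 1)))
    rw [hc, hh] at this
    exact_mod_cast this

end IsInfOfPrimesOfHeight

end PrimeDecomposition

/-! ### Leading coefficients when the generators are linear -/

section LinearStep

open Polynomial in
/-- If the pairs `(q, r)` with `X * q - r` in a set of linear generators are proportional modulo the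
prime `N`, then the leading coefficients of the ideal generated by `N` and these linear polynomials
lie in the ideal generated by `N` and the `q`s, and the constants lie in `N`. -/
lemma Polynomial.leadingCoeff_mem_of_linear {S ι : Type*} [CommRing S] {N C' : Ideal S}
    [hN : N.IsPrime] (hNC : N ≤ C') {T : Set ι} {q r : ι → S} (hq : ∀ j ∈ T, q j ∈ C') {i : ι} (hi : q i ∉ N)
    (hqr : ∀ j ∈ T, r i * q j - q i * r j ∈ N) {f : S[X]}
    (hf : f ∈ N.map C ⊔ Ideal.span ((fun j => X * C (q j) - C (r j)) '' T)) :
    f.leadingCoeff ∈ C' ∧ (f.natDegree = 0 → f.coeff 0 ∈ N) := by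
  classical
  -- Pairs proportional to `(q i, r i)` modulo `N`. Since `q i` is nonzero modulo the prime `N`, a
  -- first entry in `N` forces the second into `N`.
  let U : Submodule S (S × S) :=
    { carrier := {p | p.1 ∈ C' ∧ r i * p.1 - q i * p.2 ∈ N}
      zero_mem' := by simp
      add_mem' := by
        rintro p p' ⟨h1, h2⟩ ⟨h3, h4⟩
        refine ⟨C'.add_mem h1 h3, ?_⟩
        convert! N.add_mem h2 h4 using 1
        simp only [Prod.fst_add, Prod.snd_add]
        ring
      smul_mem' := by
        rintro c p ⟨h1, h2⟩
        refine ⟨C'.mul_mem_left c h1, ?_⟩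
        convert! N.mul_mem_left c h2 using 1
        simp only [Prod.smul_fst, Prod.smul_snd, smul_eq_mul]
        ring }
  have hU : ∀ p ∈ U, p.1 ∈ N → p.2 ∈ N := by
    rintro p ⟨-, h2⟩ h3
    have : q i * p.2 ∈ N := by
      convert! N.sub_mem (N.mul_mem_left (r i) h3) h2 using 1
      ring
    exact (hN.mem_or_mem this).resolve_left hi
  -- These combinations contain all generators; the coefficients of `g` and `h` stay paired, so
  -- cancellation between `X * g` and `h` can be traced.
  let J : Ideal S[X] :=
    { carrier := {f | ∃ g h : S[X], (∀ k, (g.coeff k, h.coeff k) ∈ U) ∧ f = X * g - h}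
      zero_mem' := ⟨0, 0, by simp [← Prod.zero_eq_mk], by simp⟩
      add_mem' := by
        rintro _ _ ⟨g, h, hgh, rfl⟩ ⟨g', h', hgh', rfl⟩
        refine ⟨g + g', h + h', fun k => ?_, by ring⟩
        simpa using U.add_mem (hgh k) (hgh' k)
      smul_mem' := by
        rintro a _ ⟨g, h, hgh, rfl⟩
        refine ⟨a * g, a * h, fun k => ?_, by simp only [smul_eq_mul]; ring⟩
        rw [coeff_mul, coeff_mul]
        have : (∑ x ∈ Finset.HasAntidiagonal.antidiagonal k, a.coeff x.1 * g.coeff x.2,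
            ∑ x ∈ Finset.HasAntidiagonal.antidiagonal k, a.coeff x.1 * h.coeff x.2) =
            ∑ x ∈ Finset.HasAntidiagonal.antidiagonal k, a.coeff x.1 • (g.coeff x.2, h.coeff x.2) := by
          ext <;> simp [Prod.fst_sum, Prod.snd_sum]
        rw [this]
        exact U.sum_mem fun x _ => U.smul_mem _ (hgh _) }
  have hJ : f ∈ J := by
    refine (sup_le ?_ ?_ : _ ≤ J) hf
    · rw [Ideal.map_le_iff_le_comap]
      intro n hn
      refine ⟨0, -C n, fun k => ⟨by simp, ?_⟩, by simp⟩
      rw [coeff_neg, coeff_C]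
      split_ifs
      · simpa using N.mul_mem_left (q i) hn
      · simp
    · refine Ideal.span_le.mpr ?_
      rintro _ ⟨j, hj, rfl⟩
      refine ⟨C (q j), C (r j), fun k => ?_, rfl⟩
      rw [coeff_C, coeff_C]
      split_ifs
      · exact ⟨hq j hj, hqr j hj⟩
      · exact U.zero_mem
  obtain ⟨g, h, hgh, rfl⟩ := hJ
  set m := (X * g - h).natDegree with hm
  have hcoeff : ∀ k, (X * g - h).coeff (k + 1) = g.coeff k - h.coeff (k + 1) := by
    intro k
    rw [coeff_sub, coeff_X_mul]
  -- Descent from above the degree of `g`: `g.coeff (k + 1) ∈ N` gives `h.coeff (k + 1) ∈ N`, which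
  -- equals `g.coeff k` because the coefficient of `f` at `k + 1 > m` vanishes.
  have hmem : ∀ n k, m ≤ k → g.natDegree < k + n → g.coeff k ∈ N := by
    intro n
    induction n with
    | zero =>
      intro k _ hk
      rw [coeff_eq_zero_of_natDegree_lt (by omega)]
      exact N.zero_mem
    | succ n ih =>
      intro k hmk hk
      have h1 := hU _ (hgh (k + 1)) (ih (k + 1) (by omega) (by omega))
      have h2 := hcoeff k
      rw [coeff_eq_zero_of_natDegree_lt (by omega)] at h2
      rwa [sub_eq_zero.mp h2.symm]
  have hhm : h.coeff m ∈ N :=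
    hU _ (hgh m) (hmem (g.natDegree + 1) m le_rfl (by omega))
  have h0 : m = 0 → (X * g - h).coeff 0 ∈ N := by
    intro h0
    rw [coeff_sub, coeff_X_mul_zero, zero_sub]
    rw [h0] at hhm
    exact N.neg_mem hhm
  refine ⟨?_, h0⟩
  rw [leadingCoeff, ← hm]
  rcases hm' : m with _ | k
  · exact hNC (h0 hm')
  · rw [hcoeff, ← hm']
    exact C'.sub_mem (hgh k).1 (hNC hhm)

end LinearStep

/-! ### The two decomposition steps, with heights -/

section IsGVDOfHeight

variable {K : Type v} [Field K] {σ : Type u}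

/-- `I` is geometrically vertex decomposable and a finite intersection of prime ideals of
height `h`. -/
structure IsGVDOfHeight (h : ℕ) (I : Ideal (MvPolynomial σ K)) : Prop where
  isGVD : IsGVD I
  isInfOfPrimes : IsInfOfPrimesOfHeight h I

lemma IsInfOfPrimesOfHeight.height_eq {R : Type*} [CommRing R] {h : ℕ} {I : Ideal R}
    [hp : I.IsPrime] (hI : IsInfOfPrimesOfHeight h I) : I.height = h := by
  obtain ⟨S, hS, rfl⟩ := hI
  obtain ⟨P, hP, hle⟩ := hp.inf_le'.mp le_rfl
  rw [le_antisymm (Finset.inf_le hP) hle]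
  exact (hS P hP).2

namespace IsGVDOfHeight

lemma top [Finite σ] (h : ℕ) : IsGVDOfHeight h (⊤ : Ideal (MvPolynomial σ K)) :=
  ⟨.top _ (IsInfOfPrimesOfHeight.top (h := 0)).isUnmixedIdeal rfl, .top⟩

lemma bot [Finite σ] : IsGVDOfHeight 0 (⊥ : Ideal (MvPolynomial σ K)) := by
  have h : IsInfOfPrimesOfHeight 0 (⊥ : Ideal (MvPolynomial σ K)) :=
    .of_isPrime Ideal.isPrime_bot (by simp)
  exact ⟨.variables _ h.isUnmixedIdeal ∅ (by simp), h⟩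

variable {y : σ} {h : ℕ} {N C : Ideal (MvPolynomial {x : σ // x ≠ y} K)}

/-- Since `N ≤ C`, the ideal `N + y * C` equals `(N + (y)) ∩ C`, and both parts are intersections of
primes of height `h + 1`. Each `c ∈ C` is attained as the coefficient of `y` in `c * y`. -/
theorem of_X_mul [Finite σ] (hNC : N ≤ C) (hN : IsGVDOfHeight h N)
    (hC : IsGVDOfHeight (h + 1) C) :
    IsGVDOfHeight (h + 1) (N.map (rename (R := K) (Subtype.val : {x : σ // x ≠ y} → σ)) ⊔
      Ideal.span {X y} * C.map (rename (R := K) (Subtype.val : {x : σ // x ≠ y} → σ))) := by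
  set I := N.map (rename (R := K) (Subtype.val : {x : σ // x ≠ y} → σ)) ⊔
      Ideal.span {X y} * C.map (rename (R := K) (Subtype.val : {x : σ // x ≠ y} → σ)) with hI
  have hI' : I = ((N.comap Polynomial.constantCoeff) ⊓ C.map Polynomial.C).comap
      (splitOff y : MvPolynomial σ K ≃ₐ[K] _).toRingEquiv := by
    apply le_antisymm
    · refine sup_le ?_ ?_
      · intro f hf
        rw [mem_map_rename_iff] at hf
        exact ⟨hf 0, Ideal.mem_map_C_iff.mpr fun n => hNC (hf n)⟩
      · refine Ideal.span_singleton_mul_le_iff.mpr fun f hf => ?_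
        rw [mem_map_rename_iff, ← Ideal.mem_map_C_iff] at hf
        have h1 : splitOff y (X y * f) = Polynomial.X * splitOff y f := by
          rw [map_mul, splitOff_X_self]
        change splitOff y (X y * f) ∈ N.comap Polynomial.constantCoeff ⊓ C.map Polynomial.C
        rw [h1]
        exact ⟨by simp, Ideal.mul_mem_left _ _ hf⟩
    · rintro f ⟨h1, h2⟩
      replace h1 : (splitOff y f).coeff 0 ∈ N := h1
      replace h2 : splitOff y f ∈ C.map Polynomial.C := h2
      rw [Ideal.mem_map_C_iff] at h2
      have h3 : f = X y * (splitOff y).symm (splitOff y f).divX +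
          rename Subtype.val ((splitOff y f).coeff 0) := by
        apply (splitOff y).injective
        rw [map_add, map_mul, splitOff_X_self, AlgEquiv.apply_symm_apply, splitOff_rename,
          Polynomial.X_mul_divX_add]
      rw [h3]
      refine I.add_mem (Ideal.mem_sup_right ?_) (Ideal.mem_sup_left (Ideal.mem_map_of_mem _ h1))
      refine Ideal.mul_mem_mul (Ideal.mem_span_singleton_self _) ?_
      rw [mem_map_rename_iff]
      intro n
      rw [AlgEquiv.apply_symm_apply, Polynomial.coeff_divX]
      exact h2 _
  have hdec : IsInfOfPrimesOfHeight (h + 1) I := by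
    rw [hI']
    exact (hN.isInfOfPrimes.comap_constantCoeff.inf hC.isInfOfPrimes.map_C).comap_ringEquiv _
  have hmem : ∀ f, f ∈ I ↔ (splitOff y f).coeff 0 ∈ N ∧ ∀ n, (splitOff y f).coeff n ∈ C := by
    intro f
    rw [← Ideal.mem_map_C_iff, hI']
    rfl
  refine ⟨.of_splitOff (y := y) hdec.isUnmixedIdeal (fun f hf => ((hmem f).mp hf).2 _)
    (fun c hc => ⟨0, ?_⟩) (fun p => ?_) hC.isGVD hN.isGVD, hdec⟩
  · rw [map_zero, add_zero, mul_comm]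
    exact Ideal.mem_sup_right
      (Ideal.mul_mem_mul (Ideal.mem_span_singleton_self _) (Ideal.mem_map_of_mem _ hc))
  · rw [hmem, splitOff_rename, Polynomial.coeff_C_zero]
    refine ⟨fun hp => ⟨hp, fun n => ?_⟩, fun hp => hp.1⟩
    rw [Polynomial.coeff_C]
    split_ifs
    · exact hNC hp
    · exact C.zero_mem

/-- Proportionality modulo `N` prevents cancellation of leading terms from producing anything
outside `N + (q j)`, and keeps the `y`-free part equal to `N`. The prime `I` contracts to `N` but is
not extended from it because `q i ∉ N`, so its height is `h + 1`. -/
theorem of_linear [Finite σ] {ι : Type*} {T : Set ι}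
    {q r : ι → MvPolynomial {x : σ // x ≠ y} K} {i : ι} (hiT : i ∈ T) (hi : q i ∉ N)
    (hqr : ∀ j ∈ T, r i * q j - q i * r j ∈ N) (hNp : N.IsPrime)
    (hN : IsGVDOfHeight h N) (hC : IsGVDOfHeight (h + 1) (N ⊔ Ideal.span (q '' T)))
    {I : Ideal (MvPolynomial σ K)} (hIp : I.IsPrime)
    (hI : I = N.map (rename (R := K) (Subtype.val : {x : σ // x ≠ y} → σ)) ⊔
      Ideal.span ((fun j => X y * rename Subtype.val (q j) - rename Subtype.val (r j)) '' T)) :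
    IsGVDOfHeight (h + 1) I := by
  classical
  have hIle : I.map (splitOff y) ≤ N.map Polynomial.C ⊔ Ideal.span
      ((fun j => Polynomial.X * Polynomial.C (q j) - Polynomial.C (r j)) '' T) := by
    rw [hI, Ideal.map_sup, map_splitOff_map_rename, Ideal.map_span, ← Set.image_comp]
    refine sup_le_sup_left (le_of_eq ?_) _
    congr 1
    refine Set.image_congr fun j _ => ?_
    simp only [Function.comp_apply, map_sub, map_mul, splitOff_X_self, splitOff_rename]
  have key : ∀ f ∈ I, (splitOff y f).leadingCoeff ∈ N ⊔ Ideal.span (q '' T) ∧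
      ((splitOff y f).natDegree = 0 → (splitOff y f).coeff 0 ∈ N) := fun f hf =>
    Polynomial.leadingCoeff_mem_of_linear le_sup_left
      (fun j hj => Ideal.mem_sup_right (Ideal.subset_span (Set.mem_image_of_mem q hj))) hi hqr
      (hIle (Ideal.mem_map_of_mem _ hf))
  have hcontr : ∀ p, p ∈ N ↔ rename Subtype.val p ∈ I := by
    intro p
    constructor
    · intro hp
      rw [hI]
      exact Ideal.mem_sup_left (Ideal.mem_map_of_mem _ hp)
    · intro hp
      have := (key _ hp).2 (by rw [splitOff_rename, Polynomial.natDegree_C])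
      rwa [splitOff_rename, Polynomial.coeff_C_zero] at this
  have hgen : ∀ j ∈ T, X y * rename Subtype.val (q j) - rename Subtype.val (r j) ∈ I := by
    intro j hj
    rw [hI]
    exact Ideal.mem_sup_right (Ideal.subset_span ⟨j, hj, rfl⟩)
  have hheight : I.height = (h + 1 : ℕ) := by
    let e := (splitOff y : MvPolynomial σ K ≃ₐ[K] _).toRingEquiv
    have hmem : ∀ f, splitOff y f ∈ I.comap e.symm ↔ f ∈ I := by
      intro f
      rw [Ideal.mem_comap]
      have : e.symm (splitOff y f) = f := (splitOff y).symm_apply_apply f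
      rw [this]
    have hprime : (I.comap e.symm).IsPrime := Ideal.comap_isPrime e.symm I
    have hc : (I.comap e.symm).comap Polynomial.C = N := by
      ext p
      rw [Ideal.mem_comap, ← splitOff_rename, hmem, hcontr]
    have := Polynomial.height_eq_height_comap_add_one (I.comap e.symm) (by
      rw [hc]
      intro heq
      have h1 := (hmem _).mpr (hgen i hiT)
      rw [heq, Ideal.mem_map_C_iff] at h1
      apply hi
      simpa [splitOff_X_self, splitOff_rename, Polynomial.coeff_C] using h1 1)
    rw [hc, hN.isInfOfPrimes.height_eq, e.symm.height_comap] at this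
    exact_mod_cast this
  have hdec : IsInfOfPrimesOfHeight (h + 1) I := .of_isPrime hIp hheight
  refine ⟨.of_splitOff (y := y) hdec.isUnmixedIdeal (fun f hf => (key f hf).1) (fun c hc => ?_)
    hcontr hC.isGVD hN.isGVD, hdec⟩
  obtain ⟨n, hn, d, hd, rfl⟩ := Submodule.mem_sup.mp hc
  have hd' : ∃ r, rename Subtype.val d * X y +
      rename (Subtype.val : {x : σ // x ≠ y} → σ) r ∈ I := by
    refine Submodule.span_induction ?_ ?_ ?_ ?_ hd
    · rintro _ ⟨j, hj, rfl⟩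
      refine ⟨-r j, ?_⟩
      rw [map_neg, ← sub_eq_add_neg, mul_comm]
      exact hgen j hj
    · exact ⟨0, by simp⟩
    · rintro p p' _ _ ⟨s, hs⟩ ⟨s', hs'⟩
      refine ⟨s + s', ?_⟩
      convert! I.add_mem hs hs' using 1
      rw [map_add, map_add]
      ring
    · rintro a p _ ⟨s, hs⟩
      refine ⟨a * s, ?_⟩
      convert! I.mul_mem_left (rename Subtype.val a) hs using 1
      rw [smul_eq_mul, map_mul, map_mul]
      ring
  obtain ⟨s, hs⟩ := hd'
  refine ⟨s, ?_⟩
  convert! I.add_mem (I.mul_mem_left (X y) ((hcontr n).mp hn)) hs using 1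
  rw [map_add]
  ring

end IsGVDOfHeight

end IsGVDOfHeight

/-! ### Minors of two-row matrices of squarefree monomials -/

section Minors

variable (K : Type v) [Field K] {σ : Type u} {ι : Type*}

/-- The squarefree monomial with support `F`. -/
noncomputable def squarefreeMonomial (F : Finset σ) : MvPolynomial σ K := ∏ x ∈ F, X x

/-- The ideal of `2`-minors of the matrix with two rows whose columns, for `i ∈ T`, consist of the
squarefree monomials with supports `a i` and `b i`. -/
noncomputable def minorsIdeal (a b : ι → Finset σ) (T : Finset ι) : Ideal (MvPolynomial σ K) :=
  Ideal.span {f | ∃ i ∈ T, ∃ j ∈ T, f = squarefreeMonomial K (a i) * squarefreeMonomial K (b j) -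
    squarefreeMonomial K (a j) * squarefreeMonomial K (b i)}

variable {K} {a b : ι → Finset σ} {T : Finset ι}

lemma minor_mem_minorsIdeal {i j : ι} (hi : i ∈ T) (hj : j ∈ T) :
    squarefreeMonomial K (a i) * squarefreeMonomial K (b j) -
      squarefreeMonomial K (a j) * squarefreeMonomial K (b i) ∈ minorsIdeal K a b T :=
  Ideal.subset_span ⟨i, hi, j, hj, rfl⟩

lemma minorsIdeal_mono {T' : Finset ι} (h : T ⊆ T') : minorsIdeal K a b T ≤ minorsIdeal K a b T' :=
  Ideal.span_mono fun _ ⟨i, hi, j, hj, hf⟩ => ⟨i, h hi, j, h hj, hf⟩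

/-- All minors vanish at the point with all coordinates one, so the ideal contains no monomial; this
supplies `q i ∉ N` in the linear step. -/
lemma minorsIdeal_le_ker_eval_one :
    minorsIdeal K a b T ≤ RingHom.ker (eval (1 : σ → K)) := by
  refine Ideal.span_le.mpr ?_
  rintro _ ⟨i, -, j, -, rfl⟩
  simp [squarefreeMonomial, RingHom.mem_ker, map_prod]

lemma squarefreeMonomial_eq_monomial (F : Finset σ) :
    squarefreeMonomial K F = monomial (∑ x ∈ F, Finsupp.single x 1) 1 := by
  rw [squarefreeMonomial, monomial_sum_one]
  rfl

/-- The supports of the monomials `a i`, `b i` are pairwise disjoint. -/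
structure PairwiseDisjointSupports (a b : ι → Finset σ) : Prop where
  left : Pairwise (Function.onFun Disjoint a)
  right : Pairwise (Function.onFun Disjoint b)
  left_right : ∀ i j, Disjoint (a i) (b j)

end Minors

/-! ### Primeness of the minors ideal -/

section LatticeIdeal

variable {K : Type v} [Field K] {σ : Type u} {ι : Type*} {a b : ι → Finset σ} {T : Finset ι}

/-- If an additive map on polynomials maps monomials to monomials, its kernel is spanned by the
differences of monomials with the same image. -/
lemma mem_span_binomials_of_map_eq_zero {G : Type*} (Φ : MvPolynomial σ K →+ (G →₀ K))
    (ψ : (σ →₀ ℕ) → G) (hΦ : ∀ u c, Φ (monomial u c) = Finsupp.single (ψ u) c)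
    {f : MvPolynomial σ K} (hf : Φ f = 0) :
    f ∈ Ideal.span {p : MvPolynomial σ K |
      ∃ u v, ψ u = ψ v ∧ p = monomial u 1 - monomial v 1} := by
  classical
  let sec : G → (σ →₀ ℕ) := fun g => if h : ∃ u, ψ u = g then h.choose else 0
  have hsec : ∀ u, ψ (sec (ψ u)) = ψ u := by
    intro u
    have h : ∃ v, ψ v = ψ u := ⟨u, rfl⟩
    simp only [sec, dif_pos h]
    exact h.choose_spec
  let L : (G →₀ K) →+ MvPolynomial σ K :=
    Finsupp.liftAddHom fun g => (monomial (sec g) : K →ₗ[K] _).toAddMonoidHom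
  have hL : ∑ u ∈ f.support, monomial (sec (ψ u)) (f.coeff u) = 0 := by
    rw [← map_zero L, ← hf]
    conv_rhs => rw [f.as_sum]
    rw [map_sum, map_sum]
    refine Finset.sum_congr rfl fun u _ => ?_
    rw [hΦ, Finsupp.liftAddHom_apply_single]
    rfl
  have : f = ∑ u ∈ f.support,
      C (f.coeff u) * (monomial u 1 - monomial (sec (ψ u)) 1) := by
    simp only [mul_sub, C_mul_monomial, mul_one, Finset.sum_sub_distrib]
    rw [hL, sub_zero]
    exact f.as_sum
  rw [this]
  exact Ideal.sum_mem _ fun u _ => Ideal.mul_mem_left _ _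
    (Ideal.subset_span ⟨u, _, (hsec u).symm, rfl⟩)

open Classical in
/-- The exponent vector of `a i / b i`. -/
noncomputable def ratioExponent (a b : ι → Finset σ) (i : ι) (x : σ) : ℤ :=
  (if x ∈ a i then 1 else 0) - (if x ∈ b i then 1 else 0)

namespace PairwiseDisjointSupports

variable (hd : PairwiseDisjointSupports a b)
include hd

lemma ratioExponent_of_mem_left {i : ι} {x : σ} (hx : x ∈ a i) (k : ι) [Decidable (k = i)] :
    ratioExponent a b k x = if k = i then 1 else 0 := by
  have h1 : x ∉ b k := Finset.disjoint_left.mp (hd.left_right i k) hx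
  split_ifs with h
  · subst h
    simp [ratioExponent, hx, h1]
  · have h2 : x ∉ a k := Finset.disjoint_right.mp (hd.left h) hx
    simp [ratioExponent, h1, h2]

lemma ratioExponent_of_mem_right {i : ι} {x : σ} (hx : x ∈ b i) (k : ι) [Decidable (k = i)] :
    ratioExponent a b k x = if k = i then -1 else 0 := by
  have h1 : x ∉ a k := Finset.disjoint_right.mp (hd.left_right k i) hx
  split_ifs with h
  · subst h
    simp [ratioExponent, hx, h1]
  · have h2 : x ∉ b k := Finset.disjoint_right.mp (hd.right h) hx
    simp [ratioExponent, h1, h2]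

/-- Induction on `∑ |c i|`: for `c i > 0 > c j`, the monomial `u` is divisible by `a i * b j`, and
exchanging this factor for `a j * b i` brings both coefficients closer to zero. -/
lemma binomial_mem_minorsIdeal {c : ι → ℤ} (hc : ∑ i ∈ T, c i = 0) {u v : σ →₀ ℕ}
    (huv : ∀ x, (u x : ℤ) - v x = ∑ i ∈ T, c i * ratioExponent a b i x) :
    monomial u 1 - monomial v 1 ∈ minorsIdeal K a b T := by
  classical
  induction hn : ∑ i ∈ T, (c i).natAbs using Nat.strong_induction_on generalizing c u with
  | _ n ih =>
  subst hn
  by_cases hzero : ∀ i ∈ T, c i = 0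
  · have : u = v := by
      ext x
      have h1 := huv x
      rw [Finset.sum_eq_zero fun i hi => by rw [hzero i hi, zero_mul]] at h1
      omega
    simp [this]
  push Not at hzero
  obtain ⟨i, hi, hci⟩ := Finset.exists_pos_of_sum_zero_of_exists_nonzero c hc hzero
  obtain ⟨j, hj, hcj⟩ := Finset.exists_pos_of_sum_zero_of_exists_nonzero (fun i => -c i)
    (by rw [Finset.sum_neg_distrib, hc, neg_zero]) (by simpa using hzero)
  have hij : i ≠ j := by
    rintro rfl
    omega
  let e : Finset σ → (σ →₀ ℕ) := fun F => ∑ x ∈ F, Finsupp.single x 1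
  have he : ∀ F x, e F x = if x ∈ F then 1 else 0 := by
    intro F x
    simp [e, Finsupp.finsetSum_apply, Finsupp.single_apply]
  -- By disjointness of supports, `u - v` equals `c i > 0` on `a i` and `-c j > 0` on `b j`.
  have hle : e (a i) + e (b j) ≤ u := by
    intro x
    rw [Finsupp.add_apply, he, he]
    have h1 := huv x
    by_cases hxa : x ∈ a i
    · have hxb : x ∉ b j := Finset.disjoint_left.mp (hd.left_right i j) hxa
      simp only [hd.ratioExponent_of_mem_left hxa, mul_ite, mul_one, mul_zero,
        Finset.sum_ite_eq', hi, if_true] at h1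
      rw [if_pos hxa, if_neg hxb]
      omega
    · rw [if_neg hxa]
      split_ifs with hxb
      · simp only [hd.ratioExponent_of_mem_right hxb, mul_ite, mul_neg, mul_one, mul_zero,
          Finset.sum_ite_eq', hj, if_true] at h1
        omega
      · omega
  obtain ⟨w, rfl⟩ := exists_add_of_le hle
  let u' := e (a j) + e (b i) + w
  have h1 : monomial (e (a i) + e (b j) + w) (1 : K) - monomial u' 1 ∈ minorsIdeal K a b T := by
    have h2 := Ideal.mul_mem_right (monomial w (1 : K)) _
      (minor_mem_minorsIdeal (K := K) (a := a) (b := b) hi hj)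
    convert! h2 using 1
    simp only [squarefreeMonomial_eq_monomial, sub_mul, monomial_mul, one_mul, u', e]
  have h2 : monomial u' (1 : K) - monomial v 1 ∈ minorsIdeal K a b T := by
    let c' : ι → ℤ := fun k => c k - (if k = i then 1 else 0) + (if k = j then 1 else 0)
    refine ih _ ?_ (c := c') ?_ ?_ rfl
    · apply Finset.sum_lt_sum
      · intro k _
        simp only [c']
        by_cases hki : k = i
        · subst hki
          rw [if_pos rfl, if_neg hij]
          omega
        · rw [if_neg hki]
          split_ifs with hkj
          · subst hkj
            omega
          · omega
      · refine ⟨i, hi, ?_⟩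
        simp only [c', if_pos, if_neg hij]
        omega
    · simp only [c', Finset.sum_add_distrib, Finset.sum_sub_distrib, hc, Finset.sum_ite_eq', hi, hj,
        if_true]
      norm_num
    · intro x
      have h3 := huv x
      simp only [c', add_mul, sub_mul, Finset.sum_add_distrib, Finset.sum_sub_distrib, ite_mul,
        one_mul, zero_mul, Finset.sum_ite_eq', hi, hj, if_true, ← h3]
      simp only [u', Finsupp.add_apply, he, ratioExponent]
      push_cast
      ring
  have := Ideal.add_mem _ h1 h2
  rwa [sub_add_sub_cancel] at this

/-- The ideal is the kernel of a monomial map into the group algebra of a torsion-free group, which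
is a domain. -/
theorem isPrime_minorsIdeal (ha : ∀ i ∈ T, (a i).Nonempty) : (minorsIdeal K a b T).IsPrime := by
  classical
  rcases T.eq_empty_or_nonempty with rfl | ⟨i₀, hi₀⟩
  · have : minorsIdeal K a b ∅ = ⊥ := by simp [minorsIdeal]
    rw [this]
    exact Ideal.isPrime_bot
  have : Nonempty σ := ⟨(ha i₀ hi₀).choose⟩
  choose! x₀ hx₀ using ha
  -- The exponent at the marked variable `x₀ i ∈ a i` reads off the multiplicity of column `i`. So
  -- `ψ u = ψ v` says exactly that `u - v` is a combination of the exponents of `a i / b i` with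
  -- coefficients `u (x₀ i) - v (x₀ i)` of sum zero.
  let ψ : (σ →₀ ℕ) →+ (σ → ℤ) × ℤ :=
    { toFun := fun u => (fun x => (u x : ℤ) - ∑ i ∈ T, (u (x₀ i) : ℤ) * ratioExponent a b i x,
        ∑ i ∈ T, (u (x₀ i) : ℤ))
      map_zero' := by
        ext <;> simp
      map_add' := by
        intro u v
        ext
        · simp only [Finsupp.add_apply, Nat.cast_add, add_mul, Finset.sum_add_distrib, Prod.fst_add,
            Pi.add_apply]
          ring
        · simp [Finset.sum_add_distrib] }
  let φ : MvPolynomial σ K →+* AddMonoidAlgebra K ((σ → ℤ) × ℤ) :=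
    AddMonoidAlgebra.mapDomainRingHom K ψ
  have hφ : ∀ u c, φ (monomial u c) = AddMonoidAlgebra.single (ψ u) c := fun u c =>
    AddMonoidAlgebra.mapDomain_single
  have hker : minorsIdeal K a b T = RingHom.ker φ := by
    apply le_antisymm
    · refine Ideal.span_le.mpr ?_
      rintro _ ⟨i, hi, j, hj, rfl⟩
      simp only [SetLike.mem_coe, RingHom.mem_ker, squarefreeMonomial_eq_monomial, monomial_mul,
        map_sub, hφ, sub_eq_zero]
      congr 1
      have hea : ∀ k, ∀ l ∈ T, (((∑ x ∈ a k, Finsupp.single x 1 : σ →₀ ℕ) (x₀ l) : ℕ) : ℤ) =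
          if k = l then 1 else 0 := by
        intro k l hl
        rw [Finsupp.finsetSum_apply]
        simp only [Finsupp.single_apply, Finset.sum_ite_eq']
        by_cases hkl : k = l
        · subst hkl
          simp [hx₀ k hl]
        · have : x₀ l ∉ a k := Finset.disjoint_right.mp (hd.left hkl) (hx₀ l hl)
          simp [this, hkl]
      have heb : ∀ k, ∀ l ∈ T, (((∑ x ∈ b k, Finsupp.single x 1 : σ →₀ ℕ) (x₀ l) : ℕ) : ℤ) = 0 := by
        intro k l hl
        rw [Finsupp.finsetSum_apply]
        have : x₀ l ∉ b k := Finset.disjoint_left.mp (hd.left_right l k) (hx₀ l hl)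
        simp [Finsupp.single_apply, this]
      have hsum : ∀ k l, ∀ F : ι → ℤ, ∑ i ∈ T, (((∑ x ∈ a k, Finsupp.single x 1 +
          ∑ x ∈ b l, Finsupp.single x 1 : σ →₀ ℕ) (x₀ i) : ℕ) : ℤ) * F i =
          if k ∈ T then F k else 0 := by
        intro k l F
        rw [← Finset.sum_ite_eq T k F]
        refine Finset.sum_congr rfl fun m hm => ?_
        rw [Finsupp.add_apply, Nat.cast_add, hea k m hm, heb l m hm]
        split_ifs <;> simp
      have hsum' := fun k l => hsum k l (fun _ => 1)
      simp only [mul_one] at hsum'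
      ext x
      · simp only [ψ, AddMonoidHom.coe_mk, ZeroHom.coe_mk]
        rw [hsum, hsum, if_pos hi, if_pos hj]
        simp only [Finsupp.add_apply, Finsupp.finsetSum_apply, Finsupp.single_apply,
          Finset.sum_ite_eq', ratioExponent]
        push_cast
        ring
      · simp only [ψ, AddMonoidHom.coe_mk, ZeroHom.coe_mk]
        rw [hsum', hsum', if_pos hi, if_pos hj]
    · intro f hf
      have := mem_span_binomials_of_map_eq_zero
        ((AddMonoidAlgebra.coeffAddEquiv (R := K) (M := (σ → ℤ) × ℤ)).toAddMonoidHom.comp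
          φ.toAddMonoidHom) ψ (fun u c => by
            change (φ (monomial u c)).coeff = _
            rw [hφ]
            rfl) (f := f) (by
            change (φ f).coeff = _
            rw [RingHom.mem_ker.mp hf]
            rfl)
      refine Ideal.span_le.mpr ?_ this
      rintro _ ⟨u, v, huv, rfl⟩
      have h1 := congrArg Prod.fst huv
      have h2 : ∑ i ∈ T, (u (x₀ i) : ℤ) = ∑ i ∈ T, (v (x₀ i) : ℤ) := congrArg Prod.snd huv
      refine hd.binomial_mem_minorsIdeal (c := fun i => (u (x₀ i) : ℤ) - v (x₀ i)) ?_ fun x => ?_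
      · rw [Finset.sum_sub_distrib, h2, sub_self]
      · have h3 : (u x : ℤ) - ∑ i ∈ T, (u (x₀ i) : ℤ) * ratioExponent a b i x =
          v x - ∑ i ∈ T, (v (x₀ i) : ℤ) * ratioExponent a b i x := congrFun h1 x
        simp only [sub_mul, Finset.sum_sub_distrib]
        linarith
  rw [hker]
  exact RingHom.ker_isPrime φ

end PairwiseDisjointSupports

end LatticeIdeal

/-! ### Deleting one variable from squarefree monomials -/

section RestrictAway

variable {K : Type v} [Field K] {σ : Type u} {y : σ}

open Classical in
/-- The elements of `F` other than `y`. -/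
noncomputable def restrictAway (y : σ) (F : Finset σ) : Finset {x : σ // x ≠ y} :=
  F.subtype (· ≠ y)

@[simp]
lemma mem_restrictAway {F : Finset σ} {x : {x : σ // x ≠ y}} :
    x ∈ restrictAway y F ↔ x.1 ∈ F := by
  classical simp [restrictAway]

lemma disjoint_restrictAway {F G : Finset σ} (h : Disjoint F G) :
    Disjoint (restrictAway y F) (restrictAway y G) := by
  rw [Finset.disjoint_left] at h ⊢
  intro x hx hx'
  exact h (mem_restrictAway.mp hx) (mem_restrictAway.mp hx')

lemma restrictAway_nonempty {F : Finset σ} (hF : F.Nonempty) (hy : y ∉ F) :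
    (restrictAway y F).Nonempty := by
  obtain ⟨x, hx⟩ := hF
  exact ⟨⟨x, fun h => hy (h ▸ hx)⟩, mem_restrictAway.mpr hx⟩

lemma PairwiseDisjointSupports.restrictAway {ι : Type*} {a b : ι → Finset σ}
    (hd : PairwiseDisjointSupports a b) (y : σ) :
    PairwiseDisjointSupports (fun i => restrictAway y (a i)) (fun i => restrictAway y (b i)) :=
  ⟨fun _ _ h => disjoint_restrictAway (hd.left h), fun _ _ h => disjoint_restrictAway (hd.right h),
    fun i j => disjoint_restrictAway (hd.left_right i j)⟩

lemma rename_squarefreeMonomial_restrictAway_eq_prod [DecidableEq σ] (F : Finset σ) :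
    rename Subtype.val (squarefreeMonomial K (restrictAway y F)) =
      squarefreeMonomial K (F.erase y) := by
  classical
  rw [squarefreeMonomial, squarefreeMonomial, map_prod]
  simp only [rename_X]
  refine Finset.prod_bij (fun x _ => x.1) (fun x hx => ?_) (fun _ _ _ _ h => Subtype.ext h)
    (fun x hx => ?_) (fun _ _ => rfl)
  · exact Finset.mem_erase.mpr ⟨x.2, mem_restrictAway.mp hx⟩
  · obtain ⟨hxy, hx⟩ := Finset.mem_erase.mp hx
    exact ⟨⟨x, hxy⟩, mem_restrictAway.mpr hx, rfl⟩

lemma rename_squarefreeMonomial_restrictAway {F : Finset σ} (hy : y ∉ F) :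
    rename Subtype.val (squarefreeMonomial K (restrictAway y F)) = squarefreeMonomial K F := by
  classical
  rw [rename_squarefreeMonomial_restrictAway_eq_prod, Finset.erase_eq_of_notMem hy]

lemma X_mul_rename_squarefreeMonomial_restrictAway {F : Finset σ} (hy : y ∈ F) :
    X y * rename Subtype.val (squarefreeMonomial K (restrictAway y F)) =
      squarefreeMonomial K F := by
  classical
  rw [rename_squarefreeMonomial_restrictAway_eq_prod, squarefreeMonomial, squarefreeMonomial,
    Finset.mul_prod_erase _ _ hy]

end RestrictAway

/-! ### The induction on the number of variables -/

section Decomposition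

variable {K : Type v} [Field K] {σ : Type u} {ι : Type*}

/-- For `y` dividing `b j`, `of_X_mul` applies: `N` omits the generator `b j`, and `C` replaces it
by `b j / y`. When `b j` is used up, the ideal is the unit ideal. -/
lemma isGVDOfHeight_span_squarefreeMonomial [Finite σ] {b : ι → Finset σ} {T : Finset ι}
    (hb : Pairwise (Function.onFun Disjoint b)) :
    IsGVDOfHeight T.card (Ideal.span ((fun j => squarefreeMonomial K (b j)) '' T)) := by
  classical
  induction hn : Nat.card σ using Nat.strong_induction_on generalizing σ T with
  | _ n ih =>
  rcases T.eq_empty_or_nonempty with rfl | ⟨j, hj⟩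
  · simpa using IsGVDOfHeight.bot
  rcases (b j).eq_empty_or_nonempty with hbj | ⟨y, hy⟩
  · have : Ideal.span ((fun j => squarefreeMonomial K (b j)) '' T) = ⊤ := by
      rw [Ideal.eq_top_iff_one]
      refine Ideal.subset_span ⟨j, hj, ?_⟩
      simp [squarefreeMonomial, hbj]
    rw [this]
    exact .top _
  have hlt : Nat.card {x : σ // x ≠ y} < n := by
    rw [← hn]
    exact Finite.card_subtype_lt (x := y) (by simp)
  have hb' : Pairwise (Function.onFun Disjoint fun i => restrictAway y (b i)) := fun _ _ h =>
    disjoint_restrictAway (hb h)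
  have hnot : ∀ i, i ≠ j → y ∉ b i := fun i hi => Finset.disjoint_right.mp (hb hi) hy
  have hN := ih _ hlt (T := T.erase j) hb' rfl
  have hC := ih _ hlt (T := T) hb' rfl
  rw [← Finset.card_erase_add_one hj] at hC ⊢
  convert! IsGVDOfHeight.of_X_mul (Ideal.span_mono (Set.image_mono (by simp))) hN hC using 1
  rw [Ideal.map_span, Ideal.map_span, ← Set.image_comp, ← Set.image_comp]
  apply le_antisymm
  · refine Ideal.span_le.mpr ?_
    rintro _ ⟨i, hi, rfl⟩
    by_cases hij : i = j
    · subst hij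
      refine Ideal.mem_sup_right ?_
      simp only
      rw [← X_mul_rename_squarefreeMonomial_restrictAway hy]
      exact Ideal.mul_mem_mul (Ideal.mem_span_singleton_self _) (Ideal.subset_span ⟨i, hi, rfl⟩)
    · refine Ideal.mem_sup_left (Ideal.subset_span ⟨i, ?_, ?_⟩)
      · exact Finset.mem_coe.mpr (Finset.mem_erase.mpr ⟨hij, hi⟩)
      · exact rename_squarefreeMonomial_restrictAway (hnot i hij)
  · refine sup_le (Ideal.span_le.mpr ?_) ?_
    · rintro _ ⟨i, hi, rfl⟩
      obtain ⟨hij, hi⟩ := Finset.mem_erase.mp (Finset.mem_coe.mp hi)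
      refine Ideal.subset_span ⟨i, hi, ?_⟩
      exact (rename_squarefreeMonomial_restrictAway (hnot i hij)).symm
    · rw [Ideal.span_mul_span', Ideal.span_le]
      rintro _ ⟨_, rfl, _, ⟨i, hi, rfl⟩, rfl⟩
      simp only [Function.comp_apply]
      by_cases hij : i = j
      · subst hij
        rw [X_mul_rename_squarefreeMonomial_restrictAway hy]
        exact Ideal.subset_span ⟨i, hi, rfl⟩
      · rw [rename_squarefreeMonomial_restrictAway (hnot i hij)]
        exact Ideal.mul_mem_left _ _ (Ideal.subset_span ⟨i, hi, rfl⟩)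

variable {a b : ι → Finset σ} {T : Finset ι}

lemma map_rename_minorsIdeal {y : σ} (ha : ∀ i ∈ T, y ∉ a i) (hb : ∀ i ∈ T, y ∉ b i) :
    (minorsIdeal K (fun i => restrictAway y (a i)) (fun i => restrictAway y (b i)) T).map
      (rename (R := K) (Subtype.val : {x : σ // x ≠ y} → σ)) = minorsIdeal K a b T := by
  rw [minorsIdeal, Ideal.map_span, minorsIdeal]
  congr 1
  have key : ∀ i ∈ T, ∀ j ∈ T, rename (Subtype.val : {x : σ // x ≠ y} → σ)
      (squarefreeMonomial K (restrictAway y (a i)) * squarefreeMonomial K (restrictAway y (b j)) -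
        squarefreeMonomial K (restrictAway y (a j)) * squarefreeMonomial K (restrictAway y (b i))) =
      squarefreeMonomial K (a i) * squarefreeMonomial K (b j) -
        squarefreeMonomial K (a j) * squarefreeMonomial K (b i) := by
    intro i hi j hj
    rw [map_sub, map_mul, map_mul, rename_squarefreeMonomial_restrictAway (ha i hi),
      rename_squarefreeMonomial_restrictAway (ha j hj),
      rename_squarefreeMonomial_restrictAway (hb i hi),
      rename_squarefreeMonomial_restrictAway (hb j hj)]
  ext f
  constructor
  · rintro ⟨_, ⟨i, hi, j, hj, rfl⟩, rfl⟩
    exact ⟨i, hi, j, hj, key i hi j hj⟩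
  · rintro ⟨i, hi, j, hj, rfl⟩
    exact ⟨_, ⟨i, hi, j, hj, rfl⟩, key i hi j hj⟩

variable (K a b T) in
/-- The ideal of `2`-minors together with the products of a further squarefree monomial and the
entries `b j` of the second row. -/
noncomputable def extendedMinorsIdeal (F : Finset σ) : Ideal (MvPolynomial σ K) :=
  minorsIdeal K a b T ⊔
    Ideal.span ((fun j => squarefreeMonomial K F * squarefreeMonomial K (b j)) '' T)

lemma extendedMinorsIdeal_empty :
    extendedMinorsIdeal K a b T ∅ = Ideal.span ((fun j => squarefreeMonomial K (b j)) '' T) := by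
  have h : ∀ j ∈ T, squarefreeMonomial K (b j) ∈
      Ideal.span ((fun j => squarefreeMonomial K (b j)) '' T) := fun j hj =>
    Ideal.subset_span ⟨j, hj, rfl⟩
  simp only [extendedMinorsIdeal, squarefreeMonomial.eq_1 K ∅, Finset.prod_empty, one_mul]
  refine sup_eq_right.mpr (Ideal.span_le.mpr ?_)
  rintro _ ⟨i, hi, j, hj, rfl⟩
  exact Ideal.sub_mem _ (Ideal.mul_mem_left _ _ (h j hj)) (Ideal.mul_mem_left _ _ (h i hi))

/-- The variable `y` occurs only in the added monomials, each time as a factor, so `of_X_mul`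
applies and `C` is the same kind of ideal with `y` removed from `F`. -/
lemma isGVDOfHeight_extendedMinorsIdeal [Finite σ] {F : Finset σ}
    (hFa : ∀ i ∈ T, Disjoint F (a i)) (hFb : ∀ i ∈ T, Disjoint F (b i))
    {y : σ} (hy : y ∈ F) {h : ℕ}
    (hN : IsGVDOfHeight h
      (minorsIdeal K (fun i => restrictAway y (a i)) (fun i => restrictAway y (b i)) T))
    (hC : IsGVDOfHeight (h + 1) (extendedMinorsIdeal K (fun i => restrictAway y (a i))
      (fun i => restrictAway y (b i)) T (restrictAway y F))) :
    IsGVDOfHeight (h + 1) (extendedMinorsIdeal K a b T F) := by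
  have ha : ∀ i ∈ T, y ∉ a i := fun i hi => Finset.disjoint_left.mp (hFa i hi) hy
  have hb : ∀ i ∈ T, y ∉ b i := fun i hi => Finset.disjoint_left.mp (hFb i hi) hy
  have hgen : ∀ j ∈ T, X y * rename Subtype.val (squarefreeMonomial K (restrictAway y F) *
      squarefreeMonomial K (restrictAway y (b j))) =
      squarefreeMonomial K F * squarefreeMonomial K (b j) := by
    intro j hj
    rw [map_mul, ← mul_assoc, X_mul_rename_squarefreeMonomial_restrictAway hy,
      rename_squarefreeMonomial_restrictAway (hb j hj)]
  convert! IsGVDOfHeight.of_X_mul le_sup_left hN hC using 1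
  unfold extendedMinorsIdeal
  rw [Ideal.map_sup, map_rename_minorsIdeal ha hb, Ideal.map_span,
    ← Set.image_comp, Ideal.mul_sup, ← sup_assoc,
    sup_eq_left.mpr
      (Ideal.mul_le_right : Ideal.span {X y} * minorsIdeal K a b T ≤ minorsIdeal K a b T)]
  congr 1
  rw [Ideal.span_mul_span', Set.singleton_mul, ← Set.image_comp]
  congr 1
  exact Set.image_congr fun j hj => (hgen j hj).symm

/-- Both families are treated together: decomposing a minors ideal yields an extended one on fewer
columns, and decomposing an extended one yields a minors ideal. -/
theorem isGVDOfHeight_minorsIdeal [Finite σ] (hd : PairwiseDisjointSupports a b)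
    (ha : ∀ i ∈ T, (a i).Nonempty) (hT : T.Nonempty) :
    IsGVDOfHeight (T.card - 1) (minorsIdeal K a b T) ∧
      ∀ F : Finset σ, (∀ i ∈ T, Disjoint F (a i)) → (∀ i ∈ T, Disjoint F (b i)) →
        IsGVDOfHeight T.card (extendedMinorsIdeal K a b T F) := by
  classical
  induction hn : Nat.card σ using Nat.strong_induction_on generalizing σ T with
  | _ n ih =>
  have hlt : ∀ y : σ, Nat.card {x : σ // x ≠ y} < n := by
    intro y
    rw [← hn]
    exact Finite.card_subtype_lt (x := y) (by simp)
  constructor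
  · obtain ⟨i, hi⟩ := hT
    rcases (T.erase i).eq_empty_or_nonempty with hT' | hT'
    · have hTi : T = {i} := (Finset.erase_eq_empty_iff T i).mp hT' |>.resolve_left
        (Finset.ne_empty_of_mem hi)
      subst hTi
      have : minorsIdeal K a b {i} = ⊥ := by
        rw [minorsIdeal, Ideal.span_eq_bot]
        rintro _ ⟨j, hj, k, hk, rfl⟩
        rw [Finset.mem_singleton.mp hj, Finset.mem_singleton.mp hk, sub_self]
      rw [this]
      exact .bot
    obtain ⟨y, hy⟩ := ha i hi
    have hya : ∀ k ∈ T.erase i, y ∉ a k := fun k hk =>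
      Finset.disjoint_right.mp (hd.left (Finset.ne_of_mem_erase hk)) hy
    have hyb : ∀ k, y ∉ b k := fun k => Finset.disjoint_left.mp (hd.left_right i k) hy
    have ha' : ∀ k ∈ T.erase i, (restrictAway y (a k)).Nonempty := fun k hk =>
      restrictAway_nonempty (ha k (Finset.mem_of_mem_erase hk)) (hya k hk)
    obtain ⟨hN, hC⟩ := ih _ (hlt y) (hd.restrictAway y) ha' hT' rfl
    -- The extra monomial is `a i / y`, the common factor of the coefficients of `y` in the minors
    -- with column `i`.
    have hC := hC (restrictAway y (a i))
      (fun k hk => disjoint_restrictAway (hd.left (Finset.ne_of_mem_erase hk).symm))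
      (fun k _ => disjoint_restrictAway (hd.left_right i k))
    have hprime := (hd.restrictAway y).isPrime_minorsIdeal (K := K) ha'
    obtain ⟨j, hj⟩ := hT'
    have hcard : (T.erase i).card - 1 + 1 = (T.erase i).card :=
      Nat.sub_add_cancel (Finset.card_pos.mpr ⟨j, hj⟩)
    rw [← hcard] at hC
    rw [← Finset.card_erase_of_mem hi, ← hcard]
    refine IsGVDOfHeight.of_linear (T := (T.erase i : Finset ι))
      (q := fun j => squarefreeMonomial K (restrictAway y (a i)) *
        squarefreeMonomial K (restrictAway y (b j)))
      (r := fun j => squarefreeMonomial K (restrictAway y (a j)) *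
        squarefreeMonomial K (restrictAway y (b i))) (i := j) (Finset.mem_coe.mpr hj) ?_ ?_
      hprime hN hC (hd.isPrime_minorsIdeal ha) ?_
    · intro hmem
      have := minorsIdeal_le_ker_eval_one hmem
      simp [squarefreeMonomial, RingHom.mem_ker, map_prod] at this
    -- The cross difference is `(a i / y) * b i` times the minor on columns `j` and `k`.
    · intro k hk
      have := Ideal.mul_mem_left _ (squarefreeMonomial K (restrictAway y (a i)) *
        squarefreeMonomial K (restrictAway y (b i)))
        (minor_mem_minorsIdeal (K := K) (a := fun i => restrictAway y (a i))
          (b := fun i => restrictAway y (b i)) hj (Finset.mem_coe.mp hk))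
      convert! this using 1
      ring
    · rw [map_rename_minorsIdeal hya (fun k _ => hyb k)]
      have hgen : ∀ k ∈ T.erase i, X y * rename Subtype.val
          (squarefreeMonomial K (restrictAway y (a i)) *
            squarefreeMonomial K (restrictAway y (b k))) - rename Subtype.val
          (squarefreeMonomial K (restrictAway y (a k)) *
            squarefreeMonomial K (restrictAway y (b i))) =
          squarefreeMonomial K (a i) * squarefreeMonomial K (b k) -
            squarefreeMonomial K (a k) * squarefreeMonomial K (b i) := by
        intro k hk
        rw [map_mul, ← mul_assoc, X_mul_rename_squarefreeMonomial_restrictAway hy, map_mul,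
          rename_squarefreeMonomial_restrictAway (hyb k),
          rename_squarefreeMonomial_restrictAway (hyb i),
          rename_squarefreeMonomial_restrictAway (hya k hk)]
      apply le_antisymm
      · refine Ideal.span_le.mpr ?_
        have hmem : ∀ k ∈ T, k ≠ i → squarefreeMonomial K (a i) * squarefreeMonomial K (b k) -
            squarefreeMonomial K (a k) * squarefreeMonomial K (b i) ∈
            Ideal.span ((fun j => X y * rename Subtype.val
              (squarefreeMonomial K (restrictAway y (a i)) *
                squarefreeMonomial K (restrictAway y (b j))) - rename Subtype.val
              (squarefreeMonomial K (restrictAway y (a j)) *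
                squarefreeMonomial K (restrictAway y (b i)))) '' (T.erase i : Finset ι)) :=
          fun k hk hki => Ideal.subset_span
            ⟨k, Finset.mem_erase.mpr ⟨hki, hk⟩, hgen k (Finset.mem_erase.mpr ⟨hki, hk⟩)⟩
        rintro _ ⟨k, hk, l, hl, rfl⟩
        by_cases hki : k = i
        · subst hki
          by_cases hlk : l = k
          · subst hlk
            rw [sub_self]
            exact Ideal.zero_mem _
          · exact Ideal.mem_sup_right (hmem l hl hlk)
        · by_cases hli : l = i
          · subst hli
            rw [← neg_sub]
            exact Submodule.neg_mem _ (Ideal.mem_sup_right (hmem k hk hki))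
          · exact Ideal.mem_sup_left (minor_mem_minorsIdeal (Finset.mem_erase.mpr ⟨hki, hk⟩)
              (Finset.mem_erase.mpr ⟨hli, hl⟩))
      · refine sup_le (minorsIdeal_mono (Finset.erase_subset _ _)) (Ideal.span_le.mpr ?_)
        rintro _ ⟨k, hk, rfl⟩
        simp only [SetLike.mem_coe]
        rw [hgen k (Finset.mem_coe.mp hk)]
        exact minor_mem_minorsIdeal hi (Finset.mem_of_mem_erase (Finset.mem_coe.mp hk))
  · intro F hFa hFb
    rcases F.eq_empty_or_nonempty with rfl | ⟨y, hy⟩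
    · rw [extendedMinorsIdeal_empty]
      exact isGVDOfHeight_span_squarefreeMonomial hd.right
    have ha' : ∀ k ∈ T, (restrictAway y (a k)).Nonempty := fun k hk =>
      restrictAway_nonempty (ha k hk) (Finset.disjoint_left.mp (hFa k hk) hy)
    obtain ⟨hN, hC⟩ := ih _ (hlt y) (hd.restrictAway y) ha' hT rfl
    have hC := hC (restrictAway y F) (fun k hk => disjoint_restrictAway (hFa k hk))
      (fun k hk => disjoint_restrictAway (hFb k hk))
    have hcard : T.card - 1 + 1 = T.card := Nat.sub_add_cancel hT.card_pos
    rw [← hcard] at hC ⊢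
    exact isGVDOfHeight_extendedMinorsIdeal hFa hFb hy hN hC

end Decomposition

/-! ### Toric ideals and their binomials -/

section ToricIdeal

/-- The exponent vector of `x_a * x_b` for an edge `{a, b}`. -/
noncomputable def edgeExponent {V : Type u} (e : Sym2 V) : V →₀ ℕ :=
  Sym2.lift ⟨fun a b => Finsupp.single a 1 + Finsupp.single b 1, fun _ _ => add_comm _ _⟩ e

lemma map_X_mul_eq_monomial (K : Type v) [Field K] {V : Type u} (e : Sym2 V) :
    (e.map (X : V → MvPolynomial V K)).mul = monomial (edgeExponent e) 1 := by
  induction e with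
  | _ a b =>
    rw [Sym2.map_mk, Sym2.mul_mk, X, X, monomial_mul, mul_one]
    rfl

/-- The homomorphism whose kernel is the toric ideal of `G`. -/
noncomputable def toricHom (K : Type v) [Field K] {V : Type u} (G : SimpleGraph V) :
    MvPolynomial G.edgeSet K →ₐ[K] MvPolynomial V K :=
  aeval fun e : G.edgeSet => (Sym2.map (X : V → MvPolynomial V K) e.1).mul

lemma mem_toricIdeal_iff {K : Type v} [Field K] {V : Type u} {G : SimpleGraph V}
    {f : MvPolynomial G.edgeSet K} : f ∈ toricIdeal K G ↔ toricHom K G f = 0 := Iff.rfl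

lemma mem_span_binomials_of_mem_toricIdeal {K : Type v} [Field K] {V : Type u}
    {G : SimpleGraph V} {f : MvPolynomial G.edgeSet K} (hf : f ∈ toricIdeal K G) :
    f ∈ Ideal.span {p : MvPolynomial G.edgeSet K | ∃ u v : G.edgeSet →₀ ℕ,
      (u.sum fun e k => k • edgeExponent e.1) = (v.sum fun e k => k • edgeExponent e.1) ∧
        p = monomial u 1 - monomial v 1} := by
  have hφ : ∀ u c, toricHom K G (monomial u c) =
      monomial (u.sum fun e k => k • edgeExponent e.1) c := by
    intro u c
    simp only [toricHom, aeval_monomial, map_X_mul_eq_monomial, monomial_pow, one_pow]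
    rw [Finsupp.prod, ← monomial_sum_one, algebraMap_eq, C_mul_monomial, mul_one]
    rfl
  refine mem_span_binomials_of_map_eq_zero
    ((AddMonoidAlgebra.coeffAddEquiv (R := K) (M := V →₀ ℕ)).toAddMonoidHom.comp
      (toricHom K G).toRingHom.toAddMonoidHom) _ (fun u c => ?_) ?_
  · change AddMonoidAlgebra.coeff (toricHom K G (monomial u c)) = _
    rw [hφ]
    rfl
  · change AddMonoidAlgebra.coeff (toricHom K G f) = _
    have : toricHom K G f = 0 := hf
    rw [this]
    rfl

end ToricIdeal

/-! ### Odd cycles through a common vertex -/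

section OddCycles

/-- Even positions cover `g 0, …, g (2 * n + 1)` once each, odd positions only `g 1, …, g (2 * n)`.
-/
lemma prod_range_even_eq {M : Type*} [CommMonoid M] (g : ℕ → M) (n : ℕ) :
    ∏ j ∈ Finset.range (2 * n + 1), (if Even j then g j * g (j + 1) else 1) =
      g 0 * g (2 * n + 1) *
        ∏ j ∈ Finset.range (2 * n + 1), (if ¬ Even j then g j * g (j + 1) else 1) := by
  induction n with
  | zero => simp
  | succ n ih =>
    have h1 : ¬ Even (2 * n + 1) := by simp
    have h2 : Even (2 * n + 1 + 1) := by simp [Nat.even_add_one]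
    rw [show 2 * (n + 1) + 1 = 2 * n + 1 + 1 + 1 by ring, Finset.prod_range_succ,
      Finset.prod_range_succ, ih, Finset.prod_range_succ _ (2 * n + 1 + 1),
      Finset.prod_range_succ _ (2 * n + 1), if_neg h1, if_pos h2, if_pos h1,
      if_neg (not_not.mpr h2)]
    simp only [mul_one]
    generalize g (2 * n + 1) = x, g (2 * n + 1 + 1) = y, g (2 * n + 1 + 1 + 1) = z
    ac_rfl

variable {s : ℕ} (t : Fin s → ℕ)

lemma cycleVertex_zero (i : Fin s) : cycleVertex t i 0 = none := by
  simp [cycleVertex]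

lemma cycleVertex_injective (i : Fin s) : Function.Injective (cycleVertex t i) :=
  (Option.map_injective sigma_mk_injective).comp (finSuccEquiv (2 * t i)).injective

lemma cycleVertex_eq_none_iff {i : Fin s} {j : Fin (2 * t i + 1)} :
    cycleVertex t i j = none ↔ j = 0 := by
  rw [← cycleVertex_zero t i, (cycleVertex_injective t i).eq_iff]

lemma eq_zero_of_cycleVertex_eq {i i' : Fin s} (hi : i ≠ i') {j : Fin (2 * t i + 1)}
    {j' : Fin (2 * t i' + 1)} (h : cycleVertex t i j = cycleVertex t i' j') : j = 0 ∧ j' = 0 := by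
  rcases hj : cycleVertex t i j with _ | x
  · exact ⟨(cycleVertex_eq_none_iff t).mp hj, (cycleVertex_eq_none_iff t).mp (h ▸ hj)⟩
  · obtain ⟨k, -, hk⟩ := Option.map_eq_some_iff.mp hj
    obtain ⟨k', -, hk'⟩ := Option.map_eq_some_iff.mp (h ▸ hj)
    rw [← hk] at hk'
    exact absurd (congrArg Sigma.fst hk').symm hi

lemma Fin.one_ne_zero_of_odd {n : ℕ} (hn : 1 ≤ n) : (1 : Fin (2 * n + 1)) ≠ 0 := by
  obtain ⟨m, rfl⟩ := Nat.exists_eq_add_of_le' hn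
  exact one_ne_zero (α := Fin (2 * m + 2 + 1))

/-- Two steps around a cycle do not return to the start, so distinct positions never give the same
edge in opposite directions. -/
lemma Fin.one_add_one_ne_zero_of_odd {n : ℕ} (hn : 1 ≤ n) : (1 + 1 : Fin (2 * n + 1)) ≠ 0 := by
  obtain ⟨m, rfl⟩ := Nat.exists_eq_add_of_le' hn
  intro h
  have := congrArg Fin.val h
  change ((1 : Fin (2 * m + 1 + 2)) + (1 : Fin (2 * m + 1 + 2))).val = 0 at this
  rw [Fin.val_add, Fin.val_one, Nat.mod_eq_of_lt (by omega)] at this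
  omega

variable {t} (ht : ∀ i, 1 ≤ t i)
include ht

lemma oddCyclesGraph_adj_cycleVertex (i : Fin s) (j : Fin (2 * t i + 1)) :
    (oddCyclesGraph t).Adj (cycleVertex t i j) (cycleVertex t i (j + 1)) := by
  rw [oddCyclesGraph, SimpleGraph.iSup_adj]
  have hadj : (SimpleGraph.cycleGraph (2 * t i + 1)).Adj j (j + 1) := by
    rw [SimpleGraph.cycleGraph_adj', add_sub_cancel_left]
    right
    rw [Fin.val_one']
    exact Nat.mod_eq_of_lt (by have := ht i; omega)
  exact ⟨i, (cycleVertex_injective t i).ne hadj.ne, j, j + 1, hadj, rfl, rfl⟩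

/-- The edge of the `i`-th cycle that joins its vertices `j` and `j + 1`. -/
def cycleEdge (p : Σ i : Fin s, Fin (2 * t i + 1)) : (oddCyclesGraph t).edgeSet :=
  ⟨s(cycleVertex t p.1 p.2, cycleVertex t p.1 (p.2 + 1)), oddCyclesGraph_adj_cycleVertex ht p.1 p.2⟩

lemma cycleEdge_injective : Function.Injective (cycleEdge ht) := by
  rintro ⟨i, j⟩ ⟨i', j'⟩ h
  have h1 := congrArg Subtype.val h
  simp only [cycleEdge] at h1
  rw [Sym2.eq_iff] at h1
  by_cases hi : i = i'
  · subst hi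
    simp only [(cycleVertex_injective t i).eq_iff] at h1
    rcases h1 with ⟨h1, -⟩ | ⟨h1, h2⟩
    · rw [h1]
    · rw [h1, add_assoc, add_eq_left] at h2
      exact absurd h2 (Fin.one_add_one_ne_zero_of_odd (ht i))
  · have h1i := Fin.one_ne_zero_of_odd (ht i)
    rcases h1 with ⟨h1, h2⟩ | ⟨h1, h2⟩
    all_goals
      have h3 := (eq_zero_of_cycleVertex_eq t hi h1).1
      have h4 := (eq_zero_of_cycleVertex_eq t hi h2).1
      rw [h3, zero_add] at h4
      exact absurd h4 h1i

lemma cycleEdge_surjective : Function.Surjective (cycleEdge ht) := by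
  have key : ∀ (i : Fin s) (j k : Fin (2 * t i + 1)), (j - k).val = 1 → j = k + 1 := by
    intro i j k h
    have : j - k = 1 := by
      apply Fin.ext
      rw [h, Fin.val_one', Nat.mod_eq_of_lt (by have := ht i; omega)]
    rw [← this, add_sub_cancel]
  rintro ⟨e, he⟩
  induction e with
  | _ x y =>
    have hadj : (oddCyclesGraph t).Adj x y := he
    rw [oddCyclesGraph, SimpleGraph.iSup_adj] at hadj
    obtain ⟨i, -, j, k, hjk, rfl, rfl⟩ := hadj
    rw [SimpleGraph.cycleGraph_adj'] at hjk
    rcases hjk with h | h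
    · obtain rfl := key i j k h
      exact ⟨⟨i, k⟩, Subtype.ext Sym2.eq_swap⟩
    · obtain rfl := key i k j h
      exact ⟨⟨i, j⟩, rfl⟩

lemma cycleEdge_mk_injective (i : Fin s) : Function.Injective fun j => cycleEdge ht ⟨i, j⟩ :=
  (cycleEdge_injective ht).comp sigma_mk_injective

/-- The edges of the `i`-th cycle at even positions. -/
def evenEdges (i : Fin s) : Finset (oddCyclesGraph t).edgeSet :=
  (Finset.univ.filter fun j : Fin (2 * t i + 1) => Even j.val).map ⟨_, cycleEdge_mk_injective ht i⟩

/-- The edges of the `i`-th cycle at odd positions. -/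
def oddEdges (i : Fin s) : Finset (oddCyclesGraph t).edgeSet :=
  (Finset.univ.filter fun j : Fin (2 * t i + 1) => ¬ Even j.val).map
    ⟨_, cycleEdge_mk_injective ht i⟩

lemma mem_evenEdges {i i' : Fin s} {j : Fin (2 * t i' + 1)} :
    cycleEdge ht ⟨i', j⟩ ∈ evenEdges ht i ↔ i' = i ∧ Even j.val := by
  simp only [evenEdges, Finset.mem_map, Finset.mem_filter, Finset.mem_univ, true_and,
    Function.Embedding.coeFn_mk, (cycleEdge_injective ht).eq_iff]
  constructor
  · rintro ⟨k, hk, h⟩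
    cases h
    exact ⟨rfl, hk⟩
  · rintro ⟨rfl, h⟩
    exact ⟨j, h, rfl⟩

lemma mem_oddEdges {i i' : Fin s} {j : Fin (2 * t i' + 1)} :
    cycleEdge ht ⟨i', j⟩ ∈ oddEdges ht i ↔ i' = i ∧ ¬ Even j.val := by
  simp only [oddEdges, Finset.mem_map, Finset.mem_filter, Finset.mem_univ, true_and,
    Function.Embedding.coeFn_mk, (cycleEdge_injective ht).eq_iff]
  constructor
  · rintro ⟨k, hk, h⟩
    cases h
    exact ⟨rfl, hk⟩
  · rintro ⟨rfl, h⟩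
    exact ⟨j, h, rfl⟩

lemma pairwiseDisjointSupports_evenEdges_oddEdges :
    PairwiseDisjointSupports (evenEdges ht) (oddEdges ht) := by
  refine ⟨fun i i' h => ?_, fun i i' h => ?_, fun i i' => ?_⟩
  all_goals
    refine Finset.disjoint_left.mpr fun e => ?_
    obtain ⟨⟨k, j⟩, rfl⟩ := cycleEdge_surjective ht e
    simp only [mem_evenEdges, mem_oddEdges]
    grind

section Degrees

variable (u : (oddCyclesGraph t).edgeSet →₀ ℕ)

open Classical in
lemma sum_edgeExponent_apply (w : Option (Σ i : Fin s, Fin (2 * t i))) :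
    (u.sum fun e k => k • edgeExponent e.1) w =
      ∑ p : Σ i : Fin s, Fin (2 * t i + 1),
        ((if cycleVertex t p.1 p.2 = w then u (cycleEdge ht p) else 0) +
          if cycleVertex t p.1 (p.2 + 1) = w then u (cycleEdge ht p) else 0) := by
  have : Fintype (oddCyclesGraph t).edgeSet := Fintype.ofFinite _
  have hbij : Function.Bijective (cycleEdge ht) := ⟨cycleEdge_injective ht, cycleEdge_surjective ht⟩
  rw [Finsupp.sum_fintype _ _ (by simp), Finsupp.finsetSum_apply,
    ← (Equiv.ofBijective _ hbij).sum_comp]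
  refine Finset.sum_congr rfl fun p _ => ?_
  have h : edgeExponent (cycleEdge ht p).1 =
    Finsupp.single (cycleVertex t p.1 p.2) 1 + Finsupp.single (cycleVertex t p.1 (p.2 + 1)) 1 := rfl
  simp [h, Finsupp.single_apply]

lemma sum_edgeExponent_apply_cycleVertex (i : Fin s) {j : Fin (2 * t i + 1)} (hj : j ≠ 0) :
    (u.sum fun e k => k • edgeExponent e.1) (cycleVertex t i j) =
      u (cycleEdge ht ⟨i, j⟩) + u (cycleEdge ht ⟨i, j - 1⟩) := by
  classical
  have key : ∀ (i' : Fin s) (j' : Fin (2 * t i' + 1)),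
      cycleVertex t i' j' = cycleVertex t i j ↔ (⟨i', j'⟩ : Σ i, Fin (2 * t i + 1)) = ⟨i, j⟩ := by
    intro i' j'
    constructor
    · intro h
      by_cases hi : i' = i
      · subst hi
        rw [cycleVertex_injective t i' h]
      · exact absurd (eq_zero_of_cycleVertex_eq t hi h).2 hj
    · intro h
      cases h
      rfl
  rw [sum_edgeExponent_apply ht, Finset.sum_add_distrib]
  congr 1
  · rw [Finset.sum_eq_single ⟨i, j⟩ _ (by simp)]
    · simp
    · rintro ⟨i', j'⟩ - h
      rw [if_neg ((key i' j').not.mpr h)]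
  · rw [Finset.sum_eq_single ⟨i, j - 1⟩ _ (by simp)]
    · simp
    · rintro ⟨i', j'⟩ - h
      rw [if_neg]
      intro h'
      have h'' := (key i' (j' + 1)).mp h'
      apply h
      cases h''
      rw [add_sub_cancel_right]

lemma sum_edgeExponent_apply_none :
    (u.sum fun e k => k • edgeExponent e.1) none =
      ∑ i, (u (cycleEdge ht ⟨i, 0⟩) + u (cycleEdge ht ⟨i, -1⟩)) := by
  classical
  rw [sum_edgeExponent_apply ht, Fintype.sum_sigma]
  refine Finset.sum_congr rfl fun i _ => ?_
  simp only [cycleVertex_eq_none_iff, Finset.sum_add_distrib, add_eq_zero_iff_eq_neg]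
  congr 1
  · rw [Finset.sum_eq_single 0 (fun j _ h => if_neg h) (by simp), if_pos rfl]
  · rw [Finset.sum_eq_single (-1) (fun j _ h => if_neg h) (by simp), if_pos rfl]

end Degrees

/-- At a vertex other than the common one, only two consecutive edges meet, so equal degrees force
their exponent differences to be opposite. -/
lemma exponent_cycleEdge_sub {u v : (oddCyclesGraph t).edgeSet →₀ ℕ}
    (h : (u.sum fun e k => k • edgeExponent e.1) = v.sum fun e k => k • edgeExponent e.1)
    (i : Fin s) (n : ℕ) (hn : n < 2 * t i + 1) :
    (u (cycleEdge ht ⟨i, ⟨n, hn⟩⟩) : ℤ) - v (cycleEdge ht ⟨i, ⟨n, hn⟩⟩) =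
      if Even n then (u (cycleEdge ht ⟨i, 0⟩) : ℤ) - v (cycleEdge ht ⟨i, 0⟩)
      else -((u (cycleEdge ht ⟨i, 0⟩) : ℤ) - v (cycleEdge ht ⟨i, 0⟩)) := by
  induction n with
  | zero => simp
  | succ n ih =>
    have hne : (⟨n + 1, hn⟩ : Fin (2 * t i + 1)) ≠ 0 := by
      intro h0
      exact absurd (congrArg Fin.val h0) (by simp)
    have hsub : (⟨n + 1, hn⟩ : Fin (2 * t i + 1)) - 1 = ⟨n, by omega⟩ := by
      rw [sub_eq_iff_eq_add]
      apply Fin.ext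
      rw [Fin.val_add, Fin.val_one']
      have := ht i
      rw [Nat.mod_eq_of_lt (a := 1) (by omega), Nat.mod_eq_of_lt (by simpa using hn)]
    have h1 := DFunLike.congr_fun h (cycleVertex t i ⟨n + 1, hn⟩)
    rw [sum_edgeExponent_apply_cycleVertex ht u i hne,
      sum_edgeExponent_apply_cycleVertex ht v i hne, hsub] at h1
    have h2 := ih (by omega)
    by_cases hev : Even n
    · rw [if_pos hev] at h2
      rw [if_neg (by simpa [Nat.even_add_one] using hev)]
      omega
    · rw [if_neg hev] at h2
      rw [if_pos (by simpa [Nat.even_add_one] using hev)]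
      omega

lemma toricIdeal_le_minorsIdeal (K : Type v) [Field K] :
    toricIdeal K (oddCyclesGraph t) ≤
      minorsIdeal K (evenEdges ht) (oddEdges ht) Finset.univ := by
  classical
  intro f hf
  refine Ideal.span_le.mpr ?_ (mem_span_binomials_of_mem_toricIdeal hf)
  rintro _ ⟨u, v, huv, rfl⟩
  have hd := pairwiseDisjointSupports_evenEdges_oddEdges ht
  refine hd.binomial_mem_minorsIdeal
    (c := fun i => (u (cycleEdge ht ⟨i, 0⟩) : ℤ) - v (cycleEdge ht ⟨i, 0⟩)) ?_ fun e => ?_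
  · have h1 := DFunLike.congr_fun huv none
    rw [sum_edgeExponent_apply_none ht, sum_edgeExponent_apply_none ht] at h1
    -- The last edge has the even position `2 * t i`, so both edges of cycle `i` at the common
    -- vertex have the difference `c i`; the degree there gives `2 * ∑ c i = 0`.
    have hlast : ∀ i, (-1 : Fin (2 * t i + 1)) = ⟨2 * t i, by omega⟩ := by
      intro i
      rw [neg_eq_iff_add_eq_zero]
      apply Fin.ext
      rw [Fin.val_add, Fin.val_one']
      have := ht i
      rw [Nat.mod_eq_of_lt (a := 1) (by omega), add_comm]
      simp
    have h2 : ∀ i, (u (cycleEdge ht ⟨i, -1⟩) : ℤ) - v (cycleEdge ht ⟨i, -1⟩) =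
        (u (cycleEdge ht ⟨i, 0⟩) : ℤ) - v (cycleEdge ht ⟨i, 0⟩) := by
      intro i
      rw [hlast, exponent_cycleEdge_sub ht huv, if_pos (even_two_mul _)]
    have h3 : ∑ i, (((u (cycleEdge ht ⟨i, 0⟩) : ℤ) - v (cycleEdge ht ⟨i, 0⟩)) +
        ((u (cycleEdge ht ⟨i, -1⟩) : ℤ) - v (cycleEdge ht ⟨i, -1⟩))) = 0 := by
      have h4 := congrArg (Nat.cast : ℕ → ℤ) h1
      push_cast at h4
      rw [← sub_eq_zero, ← Finset.sum_sub_distrib] at h4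
      rw [← h4]
      exact Finset.sum_congr rfl fun i _ => by ring
    simp only [h2, ← two_mul] at h3
    rw [← Finset.mul_sum] at h3
    omega
  · obtain ⟨⟨i, j⟩, rfl⟩ := cycleEdge_surjective ht e
    rw [show j = ⟨j.val, j.2⟩ from rfl, exponent_cycleEdge_sub ht huv]
    split_ifs with hj
    · simp [hd.ratioExponent_of_mem_left ((mem_evenEdges ht).mpr ⟨rfl, hj⟩)]
    · simp [hd.ratioExponent_of_mem_right ((mem_oddEdges ht).mpr ⟨rfl, hj⟩)]

lemma toricHom_squarefreeMonomial_map (K : Type v) [Field K] (i : Fin s)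
    (S : Finset (Fin (2 * t i + 1))) :
    toricHom K (oddCyclesGraph t)
        (squarefreeMonomial K (S.map ⟨_, cycleEdge_mk_injective ht i⟩)) =
      ∏ j ∈ S, X (cycleVertex t i j) * X (cycleVertex t i (j + 1)) := by
  rw [squarefreeMonomial, Finset.prod_map, map_prod]
  refine Finset.prod_congr rfl fun j _ => ?_
  rw [toricHom, aeval_X]
  rfl

lemma toricHom_evenEdges (K : Type v) [Field K] (i : Fin s) :
    toricHom K (oddCyclesGraph t) (squarefreeMonomial K (evenEdges ht i)) =
      X none * X none * toricHom K (oddCyclesGraph t) (squarefreeMonomial K (oddEdges ht i)) := by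
  rw [evenEdges, oddEdges, toricHom_squarefreeMonomial_map, toricHom_squarefreeMonomial_map]
  -- Indices wrap around, so both `g 0` and `g (2 * t i + 1)` are the variable of the common vertex,
  -- which accounts for its square.
  let g : ℕ → MvPolynomial (Option (Σ i : Fin s, Fin (2 * t i))) K := fun j =>
    X (cycleVertex t i (Fin.ofNat (2 * t i + 1) j))
  have hg : ∀ j : Fin (2 * t i + 1), (X (cycleVertex t i j) * X (cycleVertex t i (j + 1)) :
      MvPolynomial (Option (Σ i : Fin s, Fin (2 * t i))) K) = g j.val * g (j.val + 1) := by
    intro j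
    have h1 : Fin.ofNat (2 * t i + 1) j.val = j := Fin.ofNat_val_eq_self j
    have h2 : Fin.ofNat (2 * t i + 1) (j.val + 1) = j + 1 := by
      apply Fin.ext
      simp [Fin.val_add]
    simp only [g, h1, h2]
  have h0 : g 0 = X none := by
    rw [← cycleVertex_zero t i]
    rfl
  have hn : g (2 * t i + 1) = X none := by
    have h1 : Fin.ofNat (2 * t i + 1) (2 * t i + 1) = 0 := by
      apply Fin.ext
      simp
    simp only [g, h1, cycleVertex_zero]
  have key := prod_range_even_eq g (t i)
  rw [h0, hn, ← Fin.prod_univ_eq_prod_range (fun j => if Even j then g j * g (j + 1) else 1),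
    ← Fin.prod_univ_eq_prod_range (fun j => if ¬ Even j then g j * g (j + 1) else 1)] at key
  simp only [hg, Finset.prod_filter]
  exact key

lemma minorsIdeal_le_toricIdeal (K : Type v) [Field K] :
    minorsIdeal K (evenEdges ht) (oddEdges ht) Finset.univ ≤
      toricIdeal K (oddCyclesGraph t) := by
  refine Ideal.span_le.mpr ?_
  rintro _ ⟨i, -, j, -, rfl⟩
  rw [SetLike.mem_coe, mem_toricIdeal_iff, map_sub, map_mul, map_mul,
    toricHom_evenEdges ht K i, toricHom_evenEdges ht K j]
  ring

end OddCycles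

theorem theorem1p1 (K : Type*) [Field K] {s : ℕ} (hs : 1 ≤ s) (t : Fin s → ℕ)
    (ht : ∀ i, 1 ≤ t i) :
    IsGVD (toricIdeal K (oddCyclesGraph t)) := by
  rw [le_antisymm (toricIdeal_le_minorsIdeal ht K) (minorsIdeal_le_toricIdeal ht K)]
  refine (isGVDOfHeight_minorsIdeal (pairwiseDisjointSupports_evenEdges_oddEdges ht)
    (fun i _ => ⟨cycleEdge ht ⟨i, 0⟩, (mem_evenEdges ht).mpr ⟨rfl, by simp⟩⟩)
    ⟨⟨0, hs⟩, Finset.mem_univ _⟩).1.isGVD
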